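/- Let $L\ge 1$ be an integer, $A,B,\beta_+,\beta_->0$ and $a,b\in\mathbb R$. The KMP process with slow/fast boundaries is the Markov jump process on $\Omega_L=(0,\infty)^{\{-L,\dots,L\}}$ driven by independent Poisson clocks as follows. Each bond $\{x,x+1\}$, $-L\le x\le L-1$, has a clock of rate $1$; when it rings, $(\xi_x,\xi_{x+1})$ is replaced by $\big(p(\xi_x+\xi_{x+1}),(1-p)(\xi_x+\xi_{x+1})\big)$ with $p$ uniform on $(0,1)$. At rate $A/L^a$, $\xi_{-L}$ is replaced by an exponential variable of parameter $\beta_-$; at rate $B/L^b$, $\xi_L$ is replaced by an exponential variable of parameter $\beta_+$. Let $\mu_L$ be the invariant probability measure of this process. The dual process is the Markov jump process on $\mathbb N^{\Lambda_L}$, where $\Lambda_L=\{-L,\dots,L\}\cup\{\delta(-),\delta(+)\}$ and $\mathbb N=\{0,1,2,\dots\}$, driven by independent Poisson clocks with the same rates. When the clock of the bond $\{x,x+1\}$ rings, $(n_x,n_{x+1})$ is replaced by $(q,\,n_x+n_{x+1}-q)$ with $q$ uniform on $\{0,\dots,n_x+n_{x+1}\}$. At rate $A/L^a$ all the particles at $-L$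 move to $\delta(-)$, and at rate $B/L^b$ all the particles at $L$ move to $\delta(+)$; particles at $\delta(\pm)$ stay there forever. Let $$F(n,\xi)=\frac{1}{\beta_+^{n_{\delta(+)}}\beta_-^{n_{\delta(-)}}}\prod_{x=-L}^{L}\frac{\xi_x^{n_x}}{n_x!}\,.$$ Let $k\in\mathbb N^{\Lambda_L}$ with $k_{\delta(-)}=k_{\delta(+)}=0$, put $\Vert k\Vert=\sum_{x=-L}^L k_x$, and for $0\le j\le\Vert k\Vert$ let $q_L(k,j)$ be the probability that, in the dual process started from $k$, exactly $j$ particles hit $\delta(+)$ and the other $\Vert k\Vert-j$ particles hit $\delta(-)$. Then $F(k,\cdot)$ is $\mu_L$-integrable and $$\int F(k,\xi)\,\mu_L(d\xi)=\sum_{j=0}^{\Vert k\Vert}\frac{1}{\beta_+^{j}\,\beta_-^{\Vert k\Vert-j}}\;q_L(k,j)\,.$$ -/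

import Mathlib

open MeasureTheory ProbabilityTheory

/-! ### Markov jump processes driven by finitely many independent Poisson clocks -/

/-- A finite family of independent Poisson clocks on the state space `S`. The clock `c` rings at
rate `rate c`; when it rings, the state `x` is replaced by a random state with law `update c x`. -/
structure ClockSystem (S : Type) [MeasurableSpace S] where
  Clock : Type
  [fintypeClock : Fintype Clock]
  [nonemptyClock : Nonempty Clock]
  rate : Clock → ℝ
  rate_pos : ∀ c, 0 < rate c
  update : Clock → Kernel S S
  [markovUpdate : ∀ c, IsMarkovKernel (update c)]

namespace ClockSystem

attribute [instance] fintypeClock nonemptyClock markovUpdate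

variable {S : Type} [MeasurableSpace S] (C : ClockSystem S)

/-- The rate at which some clock rings. -/
noncomputable def totalRate : ℝ := ∑ c, C.rate c

theorem totalRate_pos : 0 < C.totalRate :=
  Finset.sum_pos (fun c _ => C.rate_pos c) Finset.univ_nonempty

/-- The generator of the process: `(G f)(x) = ∑ c, rate c * ∫ [f y - f x] (update c x)(dy)`. -/
noncomputable def generator (f : S → ℝ) (x : S) : ℝ :=
  ∑ c, C.rate c * ∫ y, (f y - f x) ∂(C.update c x)

/-- The transition kernel of the embedded chain: at each ring, the ringing clock is `c` with
probability `rate c / totalRate`, and the state is then updated according to `update c`. -/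
noncomputable def jumpKernel : Kernel S S where
  toFun x := ∑ c, ENNReal.ofReal (C.rate c / C.totalRate) • C.update c x
  measurable' := by
    refine Measure.measurable_of_measurable_coe _ fun s hs => ?_
    simp only [Measure.coe_finsetSum, Finset.sum_apply, Measure.smul_apply, smul_eq_mul]
    exact Finset.measurable_sum _ fun c _ => (Kernel.measurable_coe _ hs).const_mul _

theorem jumpKernel_apply (x : S) :
    C.jumpKernel x = ∑ c, ENNReal.ofReal (C.rate c / C.totalRate) • C.update c x := rfl

instance : IsMarkovKernel C.jumpKernel := ⟨fun x => ⟨by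
  rw [jumpKernel_apply]
  simp only [Measure.coe_finsetSum, Finset.sum_apply, Measure.smul_apply, smul_eq_mul,
    measure_univ, mul_one]
  rw [← ENNReal.ofReal_sum_of_nonneg
    (fun c _ => (div_pos (C.rate_pos c) C.totalRate_pos).le), ← Finset.sum_div]
  change ENNReal.ofReal (C.totalRate / C.totalRate) = 1
  rw [div_self C.totalRate_pos.ne', ENNReal.ofReal_one]⟩⟩

/-- The jump kernel and the total rate determine the generator: `G = totalRate * (K - 1)`. -/
theorem generator_eq (f : S → ℝ) (hf : Measurable f) (M : ℝ) (hM : ∀ x, |f x| ≤ M) (x : S) :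
    C.generator f x = C.totalRate * ∫ y, (f y - f x) ∂(C.jumpKernel x) := by
  have hi : ∀ c, Integrable (fun y => f y - f x) (C.update c x) := fun c =>
    (Integrable.of_bound hf.aestronglyMeasurable M (.of_forall hM)).sub (integrable_const _)
  rw [jumpKernel_apply, integral_finsetSum_measure
    (fun c _ => (hi c).smul_measure ENNReal.ofReal_ne_top), Finset.mul_sum]
  refine Finset.sum_congr rfl fun c _ => ?_
  rw [integral_smul_measure, ENNReal.toReal_ofReal (div_pos (C.rate_pos c) C.totalRate_pos).le,
    smul_eq_mul, ← mul_assoc, mul_div_cancel₀ _ C.totalRate_pos.ne']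

/-- The law of the embedded Markov chain `(Y 0, Y 1, …)` with `Y 0 = x`. -/
noncomputable def chainLaw : Kernel S (ℕ → S) :=
  (Kernel.traj (X := fun _ : ℕ => S)
    (fun n => C.jumpKernel.comap
      (fun h : (i : Finset.Iic n) → S => h ⟨n, Finset.mem_Iic.2 le_rfl⟩) (measurable_pi_apply _))
    0).comap (fun (x : S) (_ : Finset.Iic 0) => x) (measurable_pi_lambda _ fun _ => measurable_id)

/-- The law `P_x` of the process started from `x`, on the space of pairs `(Y, s)`: `Y` is the
embedded chain and `s 0, s 1, …` are the times between consecutive rings, which are independent of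
`Y` and i.i.d. exponential of rate `totalRate` (superposition of the independent clocks). -/
noncomputable def law : Kernel S ((ℕ → S) × (ℕ → ℝ)) :=
  C.chainLaw ×ₖ Kernel.const S (Measure.infinitePi fun _ : ℕ => expMeasure C.totalRate)

instance : IsMarkovKernel C.law := by
  have := isProbabilityMeasure_expMeasure C.totalRate_pos
  unfold law chainLaw
  infer_instance

end ClockSystem

/-- The number of rings up to time `t`, when `s 0, s 1, …` are the times between rings. -/
noncomputable def ringCount (s : ℕ → ℝ) (t : ℝ) : ℕ :=
  {n : ℕ | ∑ i ∈ Finset.range (n + 1), s i ≤ t}.ncard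

/-- The state at time `t` of the jump process with embedded chain `ω.1` and times `ω.2` between
rings. -/
noncomputable def stateAt {S : Type} (t : ℝ) (ω : (ℕ → S) × (ℕ → ℝ)) : S :=
  ω.1 (ringCount ω.2 t)

theorem measurable_ringCount (t : ℝ) : Measurable fun s : ℕ → ℝ => ringCount s t := by
  have hE : ∀ F : Finset ℕ, MeasurableSet
      {s : ℕ → ℝ | {n : ℕ | ∑ i ∈ Finset.range (n + 1), s i ≤ t} = (F : Set ℕ)} := by
    intro F
    have h : {s : ℕ → ℝ | {n : ℕ | ∑ i ∈ Finset.range (n + 1), s i ≤ t} = (F : Set ℕ)} =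
        ⋂ n : ℕ, {s : ℕ → ℝ | ∑ i ∈ Finset.range (n + 1), s i ≤ t ↔ n ∈ F} := by
      ext s
      simp [Set.ext_iff]
    rw [h]
    refine MeasurableSet.iInter fun n => ?_
    have hm : MeasurableSet {s : ℕ → ℝ | ∑ i ∈ Finset.range (n + 1), s i ≤ t} :=
      measurableSet_le (by fun_prop) measurable_const
    by_cases hn : n ∈ F
    · simpa [hn] using hm
    · simp only [hn, iff_false]
      exact hm.compl
  refine measurable_to_countable' fun m => ?_
  have h : (fun s : ℕ → ℝ => ringCount s t) ⁻¹' {m} =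
      (⋃ F : Finset ℕ, ⋃ _ : F.card = m,
        {s : ℕ → ℝ | {n : ℕ | ∑ i ∈ Finset.range (n + 1), s i ≤ t} = (F : Set ℕ)}) ∪
      (⋃ _ : m = 0, (⋃ F : Finset ℕ,
        {s : ℕ → ℝ | {n : ℕ | ∑ i ∈ Finset.range (n + 1), s i ≤ t} = (F : Set ℕ)})ᶜ) := by
    ext s
    simp only [ringCount, Set.mem_preimage, Set.mem_singleton_iff, Set.mem_union, Set.mem_iUnion,
      Set.mem_ofPred_eq, Set.mem_compl_iff, exists_prop, not_exists]
    generalize {n : ℕ | ∑ i ∈ Finset.range (n + 1), s i ≤ t} = A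
    by_cases hA : A.Finite
    · obtain ⟨F, rfl⟩ := hA.exists_finset_coe
      simp only [Set.ncard_coe_finset, Finset.coe_inj]
      constructor
      · rintro rfl
        exact Or.inl ⟨F, rfl, rfl⟩
      · rintro (⟨G, hG, rfl⟩ | ⟨-, h⟩)
        · exact hG
        · exact absurd rfl (h F)
    · have hne : ∀ F : Finset ℕ, A ≠ (F : Set ℕ) := by
        rintro F rfl
        exact hA F.finite_toSet
      rw [Set.Infinite.ncard hA]
      constructor
      · intro h
        exact Or.inr ⟨h.symm, hne⟩
      · rintro (⟨G, -, h⟩ | ⟨h, -⟩)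
        · exact absurd h (hne G)
        · exact h.symm
  rw [h]
  exact (MeasurableSet.iUnion fun F => MeasurableSet.iUnion fun _ => hE F).union
    (MeasurableSet.iUnion fun _ => (MeasurableSet.iUnion hE).compl)

theorem measurable_stateAt {S : Type} [MeasurableSpace S] (t : ℝ) :
    Measurable (stateAt (S := S) t) := by
  have h : Measurable fun z : (ℕ → S) × ℕ => z.1 z.2 :=
    measurable_from_prod_countable_left fun n => measurable_pi_apply n
  exact h.comp (measurable_fst.prodMk ((measurable_ringCount t).comp measurable_snd))

namespace ClockSystem

variable {S : Type} [MeasurableSpace S] (C : ClockSystem S)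

/-- The transition kernel of the process at time `t`. -/
noncomputable def transition (t : ℝ) : Kernel S S := C.law.map (stateAt t)

instance (t : ℝ) : IsMarkovKernel (C.transition t) :=
  Kernel.IsMarkovKernel.map _ (measurable_stateAt t)

/-- `μ` is invariant for the process: if the initial state has law `μ`, then so does the state at
every time `t ≥ 0`. -/
def IsInvariant (μ : Measure S) : Prop := ∀ t : ℝ, 0 ≤ t → (C.transition t).Invariant μ

end ClockSystem

/-! ### The KMP model with slow/fast boundaries -/

/-- The parameters of the model. -/
structure KMPModel where
  L : ℕ
  A : ℝ
  B : ℝ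
  a : ℝ
  b : ℝ
  βm : ℝ
  βp : ℝ
  L_pos : 0 < L
  A_pos : 0 < A
  B_pos : 0 < B
  βm_pos : 0 < βm
  βp_pos : 0 < βp

/-- The set of positive reals. -/
abbrev PosReal : Type := {x : ℝ // 0 < x}

/-- The sites `-L, …, L`. -/
abbrev Site (L : ℕ) : Type := {x : ℤ // x ∈ Finset.Icc (-(L : ℤ)) L}

/-- The bonds `{x, x + 1}` with `-L ≤ x ≤ L - 1`, labelled by their left endpoint. -/
abbrev Bond (L : ℕ) : Type := {x : ℤ // x ∈ Finset.Ico (-(L : ℤ)) L}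

/-- The left endpoint `x` of a bond. -/
def Bond.left {L : ℕ} (e : Bond L) : Site L :=
  ⟨e.1, by have := Finset.mem_Ico.1 e.2; exact Finset.mem_Icc.2 (by omega)⟩

/-- The right endpoint `x + 1` of a bond. -/
def Bond.right {L : ℕ} (e : Bond L) : Site L :=
  ⟨e.1 + 1, by have := Finset.mem_Ico.1 e.2; exact Finset.mem_Icc.2 (by omega)⟩

/-- The site `-L`. -/
def Site.first (L : ℕ) : Site L := ⟨-(L : ℤ), Finset.mem_Icc.2 (by omega)⟩

/-- The site `L`. -/
def Site.last (L : ℕ) : Site L := ⟨(L : ℤ), Finset.mem_Icc.2 (by omega)⟩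

/-- The energy configurations, with all energies (strictly) positive. -/
abbrev Energy (L : ℕ) : Type := Site L → PosReal

/-- The exponential law of rate `β`, as a measure on the positive reals. -/
noncomputable def expPos (β : ℝ) : Measure PosReal := (expMeasure β).comap Subtype.val

theorem isProbabilityMeasure_expPos {β : ℝ} (hβ : 0 < β) : IsProbabilityMeasure (expPos β) := by
  have := isProbabilityMeasure_expMeasure hβ
  refine MeasurableEmbedding.isProbabilityMeasure_comap
    (MeasurableEmbedding.subtype_coe measurableSet_Ioi) ?_
  rw [Subtype.range_coe_subtype, ae_iff]
  have h : {x : ℝ | x ∉ {x : ℝ | 0 < x}} = Set.Iic 0 := by ext; simp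
  rw [h]
  have : expMeasure β = volume.withDensity (exponentialPDF β) := rfl
  rw [this, withDensity_apply _ measurableSet_Iic, setLIntegral_congr Iio_ae_eq_Iic.symm]
  exact lintegral_exponentialPDF_of_nonpos le_rfl

/-- The uniform law on the open interval `(0, 1)`. -/
noncomputable def unifIoo : Measure (Set.Ioo (0 : ℝ) 1) :=
  (volume : Measure ℝ).comap Subtype.val

instance : IsProbabilityMeasure unifIoo := ⟨by
  rw [unifIoo, (MeasurableEmbedding.subtype_coe measurableSet_Ioo).comap_apply,
    Set.image_univ, Subtype.range_coe, Real.volume_Ioo]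
  simp⟩

/-- The energy at the bond `e` is redistributed: `x` receives the fraction `p` and `x + 1` the
fraction `1 - p` of the total energy of the two sites. -/
def redistribute {L : ℕ} (e : Bond L) (ξ : Energy L) (p : Set.Ioo (0 : ℝ) 1) : Energy L :=
  Function.update
    (Function.update ξ e.left ⟨p * (ξ e.left + ξ e.right),
      mul_pos p.2.1 (add_pos (ξ e.left).2 (ξ e.right).2)⟩)
    e.right ⟨(1 - p) * (ξ e.left + ξ e.right),
      mul_pos (sub_pos.2 p.2.2) (add_pos (ξ e.left).2 (ξ e.right).2)⟩

theorem measurable_redistribute {L : ℕ} (e : Bond L) :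
    Measurable fun z : Energy L × Set.Ioo (0 : ℝ) 1 => redistribute e z.1 z.2 := by
  refine measurable_pi_lambda _ fun x => ?_
  unfold redistribute
  by_cases h1 : x = e.right
  · subst h1
    simp only [Function.update_self]
    exact Measurable.subtype_mk (by fun_prop)
  · simp only [Function.update_of_ne h1]
    by_cases h2 : x = e.left
    · subst h2
      simp only [Function.update_self]
      exact Measurable.subtype_mk (by fun_prop)
    · simp only [Function.update_of_ne h2]
      fun_prop

/-- The energy at the site `x` is replaced by `y`. -/
def replaceAt {L : ℕ} (x : Site L) (ξ : Energy L) (y : PosReal) : Energy L :=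
  Function.update ξ x y

theorem measurable_replaceAt {L : ℕ} (x : Site L) :
    Measurable fun z : Energy L × PosReal => replaceAt x z.1 z.2 := by
  refine measurable_pi_lambda _ fun x' => ?_
  unfold replaceAt
  by_cases h : x' = x
  · subst h
    simp only [Function.update_self]
    fun_prop
  · simp only [Function.update_of_ne h]
    fun_prop

/-- Redistribution at the bond `e` with `p` uniform on `(0, 1)`. -/
noncomputable def redistributeKernel {L : ℕ} (e : Bond L) : Kernel (Energy L) (Energy L) :=
  (Kernel.id ×ₖ Kernel.const (Energy L) unifIoo).map fun z => redistribute e z.1 z.2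

instance {L : ℕ} (e : Bond L) : IsMarkovKernel (redistributeKernel e) :=
  Kernel.IsMarkovKernel.map _ (measurable_redistribute e)

/-- Replacement of the energy at the site `x` by an exponential variable of rate `β`. -/
noncomputable def reservoirKernel {L : ℕ} (x : Site L) (β : ℝ) : Kernel (Energy L) (Energy L) :=
  (Kernel.id ×ₖ Kernel.const (Energy L) (expPos β)).map fun z => replaceAt x z.1 z.2

theorem isMarkovKernel_reservoirKernel {L : ℕ} (x : Site L) {β : ℝ} (hβ : 0 < β) :
    IsMarkovKernel (reservoirKernel x β) := by
  have := isProbabilityMeasure_expPos hβ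
  exact Kernel.IsMarkovKernel.map _ (measurable_replaceAt x)

/-- The clocks of the model: one for each bond and one for each of the two reservoirs. -/
inductive KMPClock (L : ℕ) : Type
  | bond (e : Bond L)
  | left
  | right

/-- The clocks are the bonds and two further elements. -/
def KMPClock.equiv (L : ℕ) : Bond L ⊕ Bool ≃ KMPClock L where
  toFun := Sum.elim .bond (fun i => cond i .right .left)
  invFun
    | .bond e => .inl e
    | .left => .inr false
    | .right => .inr true
  left_inv := by rintro (e | _ | _) <;> rfl
  right_inv := by rintro (e | _ | _) <;> rfl

noncomputable instance (L : ℕ) : Fintype (KMPClock L) := Fintype.ofEquiv _ (KMPClock.equiv L)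

namespace KMPModel

variable (M : KMPModel)

/-- The rates of the clocks: `1` for every bond, `A / L ^ a` on the left, `B / L ^ b` on the
right. -/
noncomputable def rate : KMPClock M.L → ℝ
  | .bond _ => 1
  | .left => M.A / (M.L : ℝ) ^ M.a
  | .right => M.B / (M.L : ℝ) ^ M.b

theorem rate_pos : ∀ c, 0 < M.rate c
  | .bond _ => one_pos
  | .left => div_pos M.A_pos (Real.rpow_pos_of_pos (Nat.cast_pos.2 M.L_pos) _)
  | .right => div_pos M.B_pos (Real.rpow_pos_of_pos (Nat.cast_pos.2 M.L_pos) _)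

/-- What happens to the energies when a clock rings. -/
noncomputable def energyUpdate : KMPClock M.L → Kernel (Energy M.L) (Energy M.L)
  | .bond e => redistributeKernel e
  | .left => reservoirKernel (Site.first M.L) M.βm
  | .right => reservoirKernel (Site.last M.L) M.βp

instance : ∀ c, IsMarkovKernel (M.energyUpdate c)
  | .bond e => inferInstanceAs (IsMarkovKernel (redistributeKernel e))
  | .left => isMarkovKernel_reservoirKernel _ M.βm_pos
  | .right => isMarkovKernel_reservoirKernel _ M.βp_pos

/-- The KMP process with slow/fast boundaries. -/
noncomputable def kmp : ClockSystem (Energy M.L) where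
  Clock := KMPClock M.L
  nonemptyClock := ⟨.left⟩
  rate := M.rate
  rate_pos := M.rate_pos
  update := M.energyUpdate

end KMPModel

theorem KMPClock.sum_eq {L : ℕ} (g : KMPClock L → ℝ) :
    ∑ c, g c = (∑ e, g (.bond e)) + g .left + g .right := by
  rw [← (KMPClock.equiv L).sum_comp g, Fintype.sum_sum_type, Fintype.sum_bool,
    add_comm (g (KMPClock.equiv L _)), ← add_assoc]
  rfl

/-- The generator of the KMP process is the expected one. -/
theorem KMPModel.kmp_generator (M : KMPModel) (f : Energy M.L → ℝ) (hf : Measurable f)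
    (ξ : Energy M.L) :
    M.kmp.generator f ξ =
      (∑ e : Bond M.L, ∫ p, (f (redistribute e ξ p) - f ξ) ∂unifIoo) +
      M.A / (M.L : ℝ) ^ M.a *
        ∫ y, (f (Function.update ξ (Site.first M.L) y) - f ξ) ∂(expPos M.βm) +
      M.B / (M.L : ℝ) ^ M.b *
        ∫ y, (f (Function.update ξ (Site.last M.L) y) - f ξ) ∂(expPos M.βp) := by
  have hm := isProbabilityMeasure_expPos M.βm_pos
  have hp := isProbabilityMeasure_expPos M.βp_pos
  have hres : ∀ (x : Site M.L) (β : ℝ) [IsProbabilityMeasure (expPos β)],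
      ∫ η, (f η - f ξ) ∂(reservoirKernel x β ξ) =
        ∫ y, (f (Function.update ξ x y) - f ξ) ∂(expPos β) := by
    intro x β _
    rw [reservoirKernel, Kernel.map_apply _ (measurable_replaceAt x), Kernel.prod_apply,
      Kernel.id_apply, Kernel.const_apply, Measure.dirac_prod,
      Measure.map_map (measurable_replaceAt x) measurable_prodMk_left,
      integral_map ((measurable_replaceAt x).comp measurable_prodMk_left).aemeasurable
        (hf.sub_const _).aestronglyMeasurable]
    rfl
  have hbond : ∀ e : Bond M.L, ∫ η, (f η - f ξ) ∂(redistributeKernel e ξ) =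
      ∫ p, (f (redistribute e ξ p) - f ξ) ∂unifIoo := by
    intro e
    rw [redistributeKernel, Kernel.map_apply _ (measurable_redistribute e), Kernel.prod_apply,
      Kernel.id_apply, Kernel.const_apply, Measure.dirac_prod,
      Measure.map_map (measurable_redistribute e) measurable_prodMk_left,
      integral_map ((measurable_redistribute e).comp measurable_prodMk_left).aemeasurable
        (hf.sub_const _).aestronglyMeasurable]
    rfl
  refine (KMPClock.sum_eq _).trans ?_
  simp only [kmp, rate, energyUpdate, one_mul, hbond, hres]

/-! ### The dual process of walkers -/

/-- The set `Λ_L`: the sites `-L, …, L` together with the absorbing sites `δ(-)` and `δ(+)`. -/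
inductive DualSite (L : ℕ) : Type
  | deltaMinus
  | site (x : Site L)
  | deltaPlus
  deriving DecidableEq

/-- `Λ_L` consists of the sites `-L, …, L` and two further elements. -/
def DualSite.equiv (L : ℕ) : Site L ⊕ Bool ≃ DualSite L where
  toFun := Sum.elim .site (fun i => cond i .deltaPlus .deltaMinus)
  invFun
    | .site x => .inl x
    | .deltaMinus => .inr false
    | .deltaPlus => .inr true
  left_inv := by rintro (e | _ | _) <;> rfl
  right_inv := by rintro (_ | e | _) <;> rfl

noncomputable instance (L : ℕ) : Fintype (DualSite L) := Fintype.ofEquiv _ (DualSite.equiv L)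

/-- The configurations of particles. -/
abbrev Config (L : ℕ) : Type := DualSite L → ℕ

/-- Of all the particles at the bond `e`, `q` are put at `x` and the others at `x + 1`. -/
def shuffle {L : ℕ} (e : Bond L) (n : Config L) (q : ℕ) : Config L :=
  Function.update (Function.update n (.site e.left) q)
    (.site e.right) (n (.site e.left) + n (.site e.right) - q)

/-- Uniform redistribution of the particles at the bond `e`: the number `q` is uniform on
`{0, …, n_x + n_{x+1}}`. -/
noncomputable def shuffleMeasure {L : ℕ} (e : Bond L) (n : Config L) : Measure (Config L) :=
  ∑ q ∈ Finset.range (n (.site e.left) + n (.site e.right) + 1),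
    ((n (.site e.left) + n (.site e.right) + 1 : ℕ) : ENNReal)⁻¹ • Measure.dirac (shuffle e n q)

/-- Uniform redistribution of the particles at the bond `e`, as a kernel. -/
noncomputable def shuffleKernel {L : ℕ} (e : Bond L) : Kernel (Config L) (Config L) :=
  Kernel.ofFunOfCountable (shuffleMeasure e)

instance {L : ℕ} (e : Bond L) : IsMarkovKernel (shuffleKernel e) := ⟨fun n => ⟨by
  change shuffleMeasure e n Set.univ = 1
  simp only [shuffleMeasure, Measure.coe_finsetSum, Finset.sum_apply, Measure.smul_apply,
    measure_univ, smul_eq_mul, mul_one, Finset.sum_const, Finset.card_range, nsmul_eq_mul]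
  exact ENNReal.mul_inv_cancel (by simp) (ENNReal.natCast_ne_top _)⟩⟩

/-- All particles at the site `x` move to `d`. -/
def absorb {L : ℕ} (x : Site L) (d : DualSite L) (n : Config L) : Config L :=
  Function.update (Function.update n (.site x) 0) d (n d + n (.site x))

namespace KMPModel

variable (M : KMPModel)

/-- What happens to the particles when a clock rings. -/
noncomputable def walkerUpdate : KMPClock M.L → Kernel (Config M.L) (Config M.L)
  | .bond e => shuffleKernel e
  | .left => Kernel.deterministic (absorb (Site.first M.L) .deltaMinus) (.of_discrete)
  | .right => Kernel.deterministic (absorb (Site.last M.L) .deltaPlus) (.of_discrete)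

instance : ∀ c, IsMarkovKernel (M.walkerUpdate c)
  | .bond e => inferInstanceAs (IsMarkovKernel (shuffleKernel e))
  | .left => by unfold walkerUpdate; infer_instance
  | .right => by unfold walkerUpdate; infer_instance

/-- The dual process of walkers; its clocks have the same rates as those of the KMP process. -/
noncomputable def walkers : ClockSystem (Config M.L) where
  Clock := KMPClock M.L
  nonemptyClock := ⟨.left⟩
  rate := M.rate
  rate_pos := M.rate_pos
  update := M.walkerUpdate

/-- The generator of the dual process is the expected one. -/
theorem walkers_generator (f : Config M.L → ℝ) (n : Config M.L) :
    M.walkers.generator f n =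
      (∑ e : Bond M.L, 1 / ((n (.site e.left) : ℝ) + n (.site e.right) + 1) *
        ∑ q ∈ Finset.range (n (.site e.left) + n (.site e.right) + 1),
          (f (shuffle e n q) - f n)) +
      M.A / (M.L : ℝ) ^ M.a * (f (absorb (Site.first M.L) .deltaMinus n) - f n) +
      M.B / (M.L : ℝ) ^ M.b * (f (absorb (Site.last M.L) .deltaPlus n) - f n) := by
  have hbond : ∀ e : Bond M.L, ∫ m, (f m - f n) ∂(shuffleKernel e n) =
      1 / ((n (.site e.left) : ℝ) + n (.site e.right) + 1) *
        ∑ q ∈ Finset.range (n (.site e.left) + n (.site e.right) + 1),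
          (f (shuffle e n q) - f n) := by
    intro e
    change ∫ m, (f m - f n) ∂(shuffleMeasure e n) = _
    rw [shuffleMeasure, integral_finsetSum_measure, Finset.mul_sum]
    · refine Finset.sum_congr rfl fun q _ => ?_
      rw [integral_smul_measure, integral_dirac, ENNReal.toReal_inv, ENNReal.toReal_natCast,
        smul_eq_mul, one_div]
      push_cast
      rfl
    · intro q _
      exact (integrable_dirac (by finiteness)).smul_measure (by simp)
  refine (KMPClock.sum_eq _).trans ?_
  simp only [walkers, rate, walkerUpdate, one_mul, hbond, Kernel.deterministic_apply,
    integral_dirac]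

/-- The duality function `F(n, ξ)`. -/
noncomputable def F (n : Config M.L) (ξ : Energy M.L) : ℝ :=
  1 / (M.βp ^ n .deltaPlus * M.βm ^ n .deltaMinus) *
    ∏ x : Site M.L, (ξ x : ℝ) ^ n (.site x) / (Nat.factorial (n (.site x)) : ℝ)

/-- The number `‖k‖` of particles of `k` at the sites `-L, …, L`. -/
noncomputable def size {L : ℕ} (k : Config L) : ℕ := ∑ x : Site L, k (.site x)

/-- `q_L(k, j)`: the probability that, in the dual process started from `k` (with no particle at
`δ(±)`), `j` particles hit `δ(+)` and the other `‖k‖ - j` hit `δ(-)`. Particles at `δ(±)` stay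
there forever and their total number is at most `‖k‖`, so this is the event that at some time there
are `j` particles at `δ(+)` and `‖k‖ - j` particles at `δ(-)`. -/
noncomputable def hitProb (k : Config M.L) (j : ℕ) : ℝ :=
  (M.walkers.law k).real {ω | ∃ t : ℝ, 0 ≤ t ∧
    stateAt t ω .deltaPlus = j ∧ stateAt t ω .deltaMinus = size k - j}

end KMPModel

/-!
The proof works with the embedded chains of the two processes, which are dual to each other with
respect to `F`.

* *Reduction to discrete time.* If `μ` is invariant for the transition kernels `P_t` at all times,
  keeping only the events of no ring and of one ring before `t` gives `exp (-λ t) μ K ≤ μ`, where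
  `K` is the jump kernel and `λ` the total rate. Letting `t → 0`, `μ K ≤ μ`, and both are
  probability measures, so `μ K = μ` (`ClockSystem.IsInvariant.invariant_jumpKernel`). Likewise,
  the times between rings are almost surely positive, so the dual process visits exactly the states
  of its embedded chain, and the hitting probabilities can be computed on the latter
  (`KMPModel.hitProb_eq`).
* *Duality.* Clock by clock, `K F(n, ·)` at `ξ` is `K' F(·, ξ)` at `n`, where `K'` is the dual jump
  kernel; this is the Beta integral and the binomial theorem at a bond, and the moments of the
  exponential law at a reservoir (`KMPModel.duality_jumpKernel`). It passes to all powers of the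
  kernels (`KMPModel.duality_chainDist`).
* *Absorption.* The particle number is conserved, and a function linear in the occupation numbers,
  with quadratic weights, is decreased in the mean by at least the number of the unabsorbed
  particles divided by `λ`. Hence the expected number of unabsorbed particles is summable along the
  dual chain and tends to `0` (`KMPModel.tendsto_lintegral_size`). Consequently the mean of a
  function that is finite on the finitely many configurations with the given number of particles
  converges to its mean over the absorbed configurations (`KMPModel.tendsto_lintegral_chainDist`).
* *Conclusion.* For every `ξ`, `K ^ m F(k, ·)` at `ξ` thus converges to a constant `h`, the
  right-hand side of the theorem. Truncation and dominated convergence give `∫ F(k, ·) dμ ≤ h`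
  (`KMPModel.lintegral_F_le`). Since all the moments `G(n) = ∫ F(n, ·) dμ` are therefore finite, and
  `G` is harmonic for the dual chain, the convergence along the dual chain, applied to `G`, gives
  `G(k) = h` (`KMPModel.lintegral_F_eq`).
-/

open Filter Topology
open scoped ENNReal

/-! ### The embedded chain -/

namespace ClockSystem

variable {S : Type} [MeasurableSpace S] (C : ClockSystem S)

instance : IsMarkovKernel C.chainLaw := by
  unfold chainLaw
  infer_instance

/-- The `m`-step transition kernel of the embedded chain. -/
noncomputable def chainDist (m : ℕ) : Kernel S S := C.chainLaw.map fun Y => Y m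

instance (m : ℕ) : IsMarkovKernel (C.chainDist m) :=
  Kernel.IsMarkovKernel.map _ (measurable_pi_apply m)

theorem chainDist_apply (m : ℕ) (x : S) :
    C.chainDist m x = (C.chainLaw x).map fun Y => Y m :=
  Kernel.map_apply _ (measurable_pi_apply m) x

theorem chainDist_zero : C.chainDist 0 = Kernel.id := by
  ext1 x
  have h : (fun Y : ℕ → S => Y 0) =
      (fun h : (i : Finset.Iic 0) → S => h ⟨0, Finset.mem_Iic.2 le_rfl⟩) ∘
        (Preorder.frestrictLe 0) := rfl
  rw [chainDist_apply, h, ← Measure.map_map (by fun_prop) (by fun_prop), chainLaw,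
    Kernel.comap_apply, Kernel.traj_map_frestrictLe_apply, Kernel.partialTraj_self,
    Kernel.id_apply, Kernel.id_apply]
  exact Measure.map_dirac' (measurable_pi_apply _) _

/-- Markov property: given the state at step `m`, the next state has law `jumpKernel`. -/
theorem chainLaw_map_step (m : ℕ) (x : S) :
    (C.chainLaw x).map (fun Y => (Y m, Y (m + 1))) = C.chainDist m x ⊗ₘ C.jumpKernel := by
  have h := Kernel.partialTraj_compProd_eq_map_traj (X := fun _ : ℕ => S)
    (κ := fun n => C.jumpKernel.comap
      (fun h : (i : Finset.Iic n) → S => h ⟨n, Finset.mem_Iic.2 le_rfl⟩) (measurable_pi_apply _))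
    (Nat.zero_le m) (x₀ := fun _ => x)
  have hf : (fun Y : ℕ → S => (Y m, Y (m + 1))) =
      Prod.map (fun h : (i : Finset.Iic m) → S => h ⟨m, Finset.mem_Iic.2 le_rfl⟩) id ∘
        (fun Y : ℕ → S => (Preorder.frestrictLe (π := fun _ => S) m Y, Y (m + 1))) := rfl
  have hg : (fun Y : ℕ → S => Y m) =
      (fun h : (i : Finset.Iic m) → S => h ⟨m, Finset.mem_Iic.2 le_rfl⟩) ∘
        (Preorder.frestrictLe m) := rfl
  rw [chainDist_apply, hf, hg, ← Measure.map_map (by fun_prop) (by fun_prop),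
    ← Measure.map_map (by fun_prop) (by fun_prop), chainLaw, Kernel.comap_apply, ← h,
    Kernel.traj_map_frestrictLe_apply]
  ext s hs
  rw [Measure.map_apply (by fun_prop) hs, Measure.compProd_apply (hs.preimage (by fun_prop)),
    Measure.compProd_apply hs, lintegral_map (Kernel.measurable_kernel_prodMk_left hs)
      (by fun_prop)]
  rfl

theorem chainDist_succ (m : ℕ) : C.chainDist (m + 1) = C.jumpKernel ∘ₖ C.chainDist m := by
  ext1 x
  have h : (fun Y : ℕ → S => Y (m + 1)) = Prod.snd ∘ fun Y : ℕ → S => (Y m, Y (m + 1)) := rfl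
  rw [chainDist_apply, h, ← Measure.map_map (by fun_prop) (by fun_prop), chainLaw_map_step,
    Kernel.comp_apply]
  exact Measure.snd_compProd _ _

theorem chainDist_succ' (m : ℕ) : C.chainDist (m + 1) = C.chainDist m ∘ₖ C.jumpKernel := by
  induction m with
  | zero => rw [chainDist_succ, chainDist_zero, Kernel.comp_id, Kernel.id_comp]
  | succ m ih => rw [chainDist_succ, ih, ← Kernel.comp_assoc, ← chainDist_succ, ih]

theorem chainDist_one : C.chainDist 1 = C.jumpKernel := by
  rw [chainDist_succ, chainDist_zero, Kernel.comp_id]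

theorem invariant_chainDist {μ : Measure S} (hμ : C.jumpKernel.Invariant μ) (m : ℕ) :
    (C.chainDist m).Invariant μ := by
  induction m with
  | zero =>
    rw [chainDist_zero]
    exact Measure.id_comp
  | succ m ih =>
    rw [chainDist_succ]
    exact hμ.comp ih

/-- A set that the jump kernel never leaves is almost surely never left by the embedded chain. -/
theorem ae_chainLaw_absorbing {A : Set S} (hA : MeasurableSet A)
    (h : ∀ y ∈ A, C.jumpKernel y Aᶜ = 0) (x : S) :
    ∀ᵐ Y ∂C.chainLaw x, ∀ m, Y m ∈ A → Y (m + 1) ∈ A := by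
  refine ae_all_iff.2 fun m => ?_
  have hs : MeasurableSet (A ×ˢ Aᶜ : Set (S × S)) := hA.prod hA.compl
  have h0 : (C.chainLaw x).map (fun Y => (Y m, Y (m + 1))) (A ×ˢ Aᶜ) = 0 := by
    rw [chainLaw_map_step, Measure.compProd_apply hs, lintegral_eq_zero_iff
      (Kernel.measurable_kernel_prodMk_left hs)]
    refine .of_forall fun y => ?_
    by_cases hy : y ∈ A
    · simpa [hy] using h y hy
    · simp [hy]
  rw [Measure.map_apply (by fun_prop) hs] at h0
  refine measure_mono_null (fun Y hY => ?_) h0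
  simpa using hY

theorem ae_chainLaw_zero [MeasurableSingletonClass S] (x : S) :
    ∀ᵐ Y ∂C.chainLaw x, Y 0 = x := by
  have h : ∀ᵐ y ∂C.chainDist 0 x, y = x := by
    rw [chainDist_zero, Kernel.id_apply, ae_dirac_eq]
    exact Filter.eventually_pure.2 rfl
  rw [chainDist_apply] at h
  exact ae_of_ae_map (measurable_pi_apply 0).aemeasurable h

/-- The probability of having reached an absorbing set by step `m` converges to the probability of
ever reaching it. -/
theorem tendsto_chainDist_absorbing {A : Set S} (hA : MeasurableSet A)
    (h : ∀ y ∈ A, C.jumpKernel y Aᶜ = 0) (x : S) :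
    Tendsto (fun m => C.chainDist m x A) atTop (𝓝 (C.chainLaw x {Y | ∃ m, Y m ∈ A})) := by
  have hmono : Monotone fun m => {Y : ℕ → S | ∃ i ≤ m, Y i ∈ A} := by
    rintro m n hmn Y ⟨i, hi, hY⟩
    exact ⟨i, hi.trans hmn, hY⟩
  have hU : {Y : ℕ → S | ∃ m, Y m ∈ A} = ⋃ m, {Y : ℕ → S | ∃ i ≤ m, Y i ∈ A} := by
    ext Y
    simp only [Set.mem_ofPred_eq, Set.mem_iUnion]
    exact ⟨fun ⟨m, hm⟩ => ⟨m, m, le_rfl, hm⟩, fun ⟨_, i, _, hi⟩ => ⟨i, hi⟩⟩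
  rw [hU]
  refine (tendsto_measure_iUnion_atTop hmono).congr fun m => ?_
  rw [chainDist_apply, Measure.map_apply (measurable_pi_apply m) hA]
  refine measure_congr ?_
  filter_upwards [C.ae_chainLaw_absorbing hA h x] with Y hY
  refine propext ⟨?_, fun hm => ⟨m, le_rfl, hm⟩⟩
  rintro ⟨i, hi, hYi⟩
  exact Nat.le_induction hYi (fun n _ hn => hY n hn) m hi

/-! ### The times between rings -/

theorem expMeasure_Ioi {r : ℝ} (hr : 0 < r) {t : ℝ} (ht : 0 ≤ t) :
    expMeasure r (Set.Ioi t) = ENNReal.ofReal (Real.exp (-(r * t))) := by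
  have := isProbabilityMeasure_expMeasure hr
  have h := cdf_expMeasure_eq hr t
  rw [if_pos ht, cdf_eq_real] at h
  rw [← Set.compl_Iic, ← ofReal_measureReal, probReal_compl_eq_one_sub measurableSet_Iic, h]
  simp

theorem expMeasure_Iic {r : ℝ} (hr : 0 < r) {t : ℝ} (ht : 0 ≤ t) :
    expMeasure r (Set.Iic t) = ENNReal.ofReal (1 - Real.exp (-(r * t))) := by
  have := isProbabilityMeasure_expMeasure hr
  have h := cdf_expMeasure_eq hr t
  rw [if_pos ht, cdf_eq_real] at h
  rw [← ofReal_measureReal, h]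

/-- The law of the sequence of the times between rings. -/
noncomputable def timesLaw : Measure (ℕ → ℝ) :=
  Measure.infinitePi fun _ : ℕ => expMeasure C.totalRate

instance : IsProbabilityMeasure C.timesLaw := by
  have := isProbabilityMeasure_expMeasure C.totalRate_pos
  unfold timesLaw
  infer_instance

theorem law_apply (x : S) : C.law x = (C.chainLaw x).prod C.timesLaw := by
  have := isProbabilityMeasure_expMeasure C.totalRate_pos
  rw [law, Kernel.prod_apply, Kernel.const_apply, timesLaw]

theorem ae_timesLaw_pos : ∀ᵐ s ∂C.timesLaw, ∀ i, 0 < s i := by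
  have := isProbabilityMeasure_expMeasure C.totalRate_pos
  refine ae_all_iff.2 fun i => ?_
  have h : ∀ᵐ u ∂expMeasure C.totalRate, 0 < u := by
    refine (prob_compl_eq_zero_iff measurableSet_Ioi).2 ?_
    rw [expMeasure_Ioi C.totalRate_pos le_rfl]
    simp
  rw [← Measure.infinitePi_map_eval (fun _ : ℕ => expMeasure C.totalRate) i] at h
  exact ae_of_ae_map (measurable_pi_apply i).aemeasurable h

theorem timesLaw_first_gt {t : ℝ} (ht : 0 ≤ t) :
    C.timesLaw {s | t < s 0} = ENNReal.ofReal (Real.exp (-(C.totalRate * t))) := by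
  have := isProbabilityMeasure_expMeasure C.totalRate_pos
  rw [← expMeasure_Ioi C.totalRate_pos ht,
    ← Measure.infinitePi_map_eval (fun _ : ℕ => expMeasure C.totalRate) 0,
    Measure.map_apply (measurable_pi_apply 0) measurableSet_Ioi]
  rfl

theorem timesLaw_first_le_second_gt {t : ℝ} (ht : 0 ≤ t) :
    C.timesLaw {s | s 0 ≤ t ∧ t < s 1} = ENNReal.ofReal (1 - Real.exp (-(C.totalRate * t))) *
      ENNReal.ofReal (Real.exp (-(C.totalRate * t))) := by
  have := isProbabilityMeasure_expMeasure C.totalRate_pos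
  have h := Measure.infinitePi_pi (μ := fun _ : ℕ => expMeasure C.totalRate)
    (s := Finset.range 2) (t := fun i => if i = 0 then Set.Iic t else Set.Ioi t)
    (fun i _ => by split_ifs <;> measurability)
  simp only [Finset.prod_range_succ, Finset.prod_range_zero, one_mul, if_true, one_ne_zero,
    if_false, expMeasure_Ioi C.totalRate_pos ht, expMeasure_Iic C.totalRate_pos ht] at h
  rw [← h, timesLaw]
  congr 1
  ext s
  simp only [Set.mem_ofPred_eq, Set.mem_pi, Finset.mem_coe, Finset.mem_range]
  constructor
  · rintro ⟨h0, h1⟩ i hi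
    interval_cases i
    · simpa using h0
    · simpa using h1
  · intro h
    exact ⟨by simpa using h 0 (by norm_num), by simpa using h 1 (by norm_num)⟩

end ClockSystem

/-- At the time of the `n`-th ring there have been exactly `n` rings. -/
theorem ringCount_sum {s : ℕ → ℝ} (hs : ∀ i, 0 < s i) (n : ℕ) :
    ringCount s (∑ i ∈ Finset.range n, s i) = n := by
  have hmono : StrictMono fun n => ∑ i ∈ Finset.range n, s i :=
    strictMono_nat_of_lt_succ fun n => by
      rw [Finset.sum_range_succ]
      linarith [hs n]
  have h : {m : ℕ | ∑ i ∈ Finset.range (m + 1), s i ≤ ∑ i ∈ Finset.range n, s i} =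
      (Finset.range n : Set ℕ) := by
    ext m
    simpa [Nat.succ_le_iff] using hmono.le_iff_le (a := m + 1) (b := n)
  rw [ringCount, h, Set.ncard_coe_finset, Finset.card_range]

theorem ringCount_eq_zero {s : ℕ → ℝ} (hs : ∀ i, 0 < s i) {t : ℝ} (h : t < s 0) :
    ringCount s t = 0 := by
  have h : {m : ℕ | ∑ i ∈ Finset.range (m + 1), s i ≤ t} = ∅ := by
    ext m
    simp only [Set.mem_ofPred_eq, Set.mem_empty_iff_false, iff_false, not_le]
    refine h.trans_le ?_
    rw [Finset.sum_range_succ']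
    linarith [Finset.sum_nonneg fun i (_ : i ∈ Finset.range m) => (hs (i + 1)).le]
  rw [ringCount, h, Set.ncard_empty]

theorem ringCount_eq_one {s : ℕ → ℝ} (hs : ∀ i, 0 < s i) {t : ℝ} (h0 : s 0 ≤ t) (h1 : t < s 1) :
    ringCount s t = 1 := by
  have h : {m : ℕ | ∑ i ∈ Finset.range (m + 1), s i ≤ t} = {0} := by
    ext m
    simp only [Set.mem_ofPred_eq, Set.mem_singleton_iff]
    constructor
    · intro h
      by_contra hm
      obtain ⟨m, rfl⟩ := Nat.exists_eq_succ_of_ne_zero hm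
      rw [Nat.succ_eq_add_one, Finset.sum_range_succ', Finset.sum_range_succ'] at h
      have := Finset.sum_nonneg fun i (_ : i ∈ Finset.range m) => (hs (i + 1 + 1)).le
      simp only [zero_add] at h
      linarith [hs 0]
    · rintro rfl
      simpa using h0
  rw [ringCount, h, Set.ncard_singleton]

namespace ClockSystem

variable {S : Type} [MeasurableSpace S] (C : ClockSystem S)

/-- A lower bound for the transition kernel at time `t`: the contribution of the event of no ring
before `t`, plus a part of the contribution of the event of exactly one ring. -/
theorem le_transition (x : S) {A : Set S} (hA : MeasurableSet A) {t : ℝ} (ht : 0 ≤ t) :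
    A.indicator 1 x * ENNReal.ofReal (Real.exp (-(C.totalRate * t))) +
      C.jumpKernel x A * (ENNReal.ofReal (1 - Real.exp (-(C.totalRate * t))) *
        ENNReal.ofReal (Real.exp (-(C.totalRate * t)))) ≤ C.transition t x A := by
  have h0 : A.indicator 1 x = C.chainLaw x {Y | Y 0 ∈ A} := by
    rw [← Measure.dirac_apply' x hA, ← Kernel.id_apply, ← C.chainDist_zero, chainDist_apply,
      Measure.map_apply (measurable_pi_apply 0) hA]
    rfl
  have h1 : C.jumpKernel x A = C.chainLaw x {Y | Y 1 ∈ A} := by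
    rw [← C.chainDist_one, chainDist_apply, Measure.map_apply (measurable_pi_apply 1) hA]
    rfl
  have hm0 : MeasurableSet {Y : ℕ → S | Y 0 ∈ A} := measurable_pi_apply 0 hA
  have hm1 : MeasurableSet {Y : ℕ → S | Y 1 ∈ A} := measurable_pi_apply 1 hA
  have hs : MeasurableSet {s : ℕ → ℝ | s 0 ≤ t ∧ t < s 1} := by measurability
  rw [← C.timesLaw_first_le_second_gt ht, ← C.timesLaw_first_gt ht, h0, h1, ← Measure.prod_prod,
    ← Measure.prod_prod, ← law_apply, transition, Kernel.map_apply' _ (measurable_stateAt t) _ hA,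
    ← measure_union _ (hm1.prod hs)]
  · refine measure_mono_ae ?_
    have hpos : ∀ᵐ ω ∂C.law x, ∀ i, 0 < ω.2 i := by
      rw [law_apply]
      exact Measure.quasiMeasurePreserving_snd.ae C.ae_timesLaw_pos
    filter_upwards [hpos] with ω hω hmem
    rcases hmem with ⟨hY, ht0⟩ | ⟨hY, ht0, ht1⟩
    · change ω.1 (ringCount ω.2 t) ∈ A
      rw [ringCount_eq_zero hω ht0]
      exact hY
    · change ω.1 (ringCount ω.2 t) ∈ A
      rw [ringCount_eq_one hω ht0 ht1]
      exact hY
  · rw [Set.disjoint_left]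
    rintro ω ⟨-, h⟩ ⟨-, h', -⟩
    exact absurd h' (not_le.2 h)

/-- A probability measure that is invariant for the jump process is invariant for the embedded
chain. -/
theorem IsInvariant.invariant_jumpKernel {μ : Measure S} [IsProbabilityMeasure μ]
    (hμ : C.IsInvariant μ) : C.jumpKernel.Invariant μ := by
  have : IsProbabilityMeasure (μ.bind C.jumpKernel) := by
    infer_instance
  refine Measure.eq_of_le_of_isProbabilityMeasure (Measure.le_iff.2 fun A hA => ?_)
  have key : ∀ t : ℝ, 0 < t →
      ENNReal.ofReal (Real.exp (-(C.totalRate * t))) * μ.bind C.jumpKernel A ≤ μ A := by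
    intro t ht
    set e := Real.exp (-(C.totalRate * t)) with he
    have he0 : 0 < e := Real.exp_pos _
    have he1 : e < 1 := Real.exp_lt_one_iff.2 (by have := C.totalRate_pos; nlinarith)
    -- Integrating `le_transition` gives `e * μ A + (1 - e) * e * (μ K) A ≤ μ A`; subtract `e * μ A`
    -- and divide by `1 - e`.
    have h1 : μ A * ENNReal.ofReal e +
        μ.bind C.jumpKernel A * (ENNReal.ofReal (1 - e) * ENNReal.ofReal e) ≤ μ A := by
      calc _ = ∫⁻ x, (A.indicator 1 x * ENNReal.ofReal e + C.jumpKernel x A *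
            (ENNReal.ofReal (1 - e) * ENNReal.ofReal e)) ∂μ := by
            rw [lintegral_add_left ((measurable_one.indicator hA).mul_const _),
              lintegral_mul_const _ (measurable_one.indicator hA), lintegral_indicator_one hA,
              lintegral_mul_const _ (Kernel.measurable_coe _ hA),
              Measure.bind_apply hA C.jumpKernel.aemeasurable]
        _ ≤ ∫⁻ x, C.transition t x A ∂μ := lintegral_mono fun x => C.le_transition x hA ht.le
        _ = μ A := by
            rw [← Measure.bind_apply hA (C.transition t).aemeasurable, (hμ t ht.le).def]
    have hfin : μ A ≠ ∞ := measure_ne_top _ _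
    have hfin' : μ.bind C.jumpKernel A ≠ ∞ := measure_ne_top _ _
    rw [← ENNReal.toReal_le_toReal (by finiteness) hfin] at h1 ⊢
    rw [ENNReal.toReal_add (by finiteness) (by finiteness)] at h1
    simp only [ENNReal.toReal_mul, ENNReal.toReal_ofReal he0.le,
      ENNReal.toReal_ofReal (sub_nonneg.2 he1.le)] at h1 ⊢
    have : (1 - e) * (e * (μ.bind C.jumpKernel A).toReal) ≤ (1 - e) * (μ A).toReal := by
      linarith
    exact le_of_mul_le_mul_left this (sub_pos.2 he1)
  have hlim : Tendsto (fun t : ℝ => ENNReal.ofReal (Real.exp (-(C.totalRate * t))) *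
      μ.bind C.jumpKernel A) (𝓝[>] 0) (𝓝 (ENNReal.ofReal (Real.exp (-(C.totalRate * 0))) *
      μ.bind C.jumpKernel A)) := by
    refine ENNReal.Tendsto.mul_const ?_ (Or.inr (measure_ne_top _ _))
    exact (ENNReal.continuous_ofReal.comp (by fun_prop)).continuousWithinAt
  simp only [mul_zero, neg_zero, Real.exp_zero, ENNReal.ofReal_one, one_mul] at hlim
  exact le_of_tendsto hlim (eventually_nhdsWithin_of_forall key)

end ClockSystem

/-! ### Duality of the two jump kernels -/

theorem lintegral_unifIoo_pow_mul_pow (a b : ℕ) :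
    ∫⁻ p, ENNReal.ofReal ((p : ℝ) ^ a * (1 - p) ^ b) ∂unifIoo =
      ENNReal.ofReal (a.factorial * b.factorial / (a + b + 1).factorial) := by
  have ha : (0 : ℝ) < a + 1 := by positivity
  have hb : (0 : ℝ) < b + 1 := by positivity
  have hbeta : beta (a + 1) (b + 1) = a.factorial * b.factorial / (a + b + 1).factorial := by
    rw [beta, Real.Gamma_nat_eq_factorial, Real.Gamma_nat_eq_factorial,
      show (a + 1 + (b + 1) : ℝ) = ((a + b + 1 : ℕ) : ℝ) + 1 by push_cast; ring,
      Real.Gamma_nat_eq_factorial]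
  have hpos := beta_pos ha hb
  have h1 := lintegral_betaPDF_eq_one ha hb
  rw [lintegral_betaPDF, setLIntegral_congr_fun (g := fun x => ENNReal.ofReal
    (1 / beta (a + 1) (b + 1)) * ENNReal.ofReal (x ^ a * (1 - x) ^ b)) measurableSet_Ioo,
    lintegral_const_mul' _ _ ENNReal.ofReal_ne_top] at h1
  · rw [unifIoo, lintegral_subtype_comap measurableSet_Ioo
      (fun p : ℝ => ENNReal.ofReal (p ^ a * (1 - p) ^ b)), ← hbeta]
    rw [one_div, ENNReal.ofReal_inv_of_pos hpos] at h1
    exact (ENNReal.eq_inv_of_mul_eq_one_left ((mul_comm _ _).trans h1)).trans (inv_inv _)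
  · intro x hx
    change ENNReal.ofReal _ = ENNReal.ofReal _ * ENNReal.ofReal _
    rw [← ENNReal.ofReal_mul (by positivity), add_sub_cancel_right, add_sub_cancel_right,
      Real.rpow_natCast, Real.rpow_natCast, mul_assoc]

theorem lintegral_expPos_pow_div_factorial {β : ℝ} (hβ : 0 < β) (n : ℕ) :
    ∫⁻ y, ENNReal.ofReal ((y : ℝ) ^ n / n.factorial) ∂expPos β = ENNReal.ofReal (1 / β ^ n) := by
  have hn : (0 : ℝ) < n + 1 := by positivity
  have h0 : (expMeasure β) = volume.withDensity (exponentialPDF β) := rfl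
  refine (lintegral_subtype_comap (μ := expMeasure β) (measurableSet_Ioi (a := (0 : ℝ)))
    (fun y : ℝ => ENNReal.ofReal (y ^ n / n.factorial))).trans ?_
  rw [h0, setLIntegral_withDensity_eq_setLIntegral_mul _ (by unfold exponentialPDF; fun_prop)
      (by fun_prop) measurableSet_Ioi,
    setLIntegral_congr_fun (g := fun y => ENNReal.ofReal (1 / β ^ n) * gammaPDF (n + 1) β y)
      measurableSet_Ioi]
  · rw [lintegral_const_mul' _ _ ENNReal.ofReal_ne_top]
    have h1 := lintegral_gammaPDF_eq_one hn hβ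
    rw [← lintegral_add_compl _ (measurableSet_Ioi (a := (0 : ℝ))), Set.compl_Ioi,
      setLIntegral_congr Iio_ae_eq_Iic.symm, lintegral_gammaPDF_of_nonpos le_rfl, add_zero] at h1
    exact (congrArg _ h1).trans (mul_one _)
  · intro y hy
    have hy : 0 < y := hy
    change exponentialPDF β y * ENNReal.ofReal _ = _ * gammaPDF _ _ _
    rw [exponentialPDF_of_nonneg hy.le, gammaPDF_of_nonneg hy.le,
      ← ENNReal.ofReal_mul (by positivity), ← ENNReal.ofReal_mul (by positivity),
      Real.Gamma_nat_eq_factorial, add_sub_cancel_right, Real.rpow_natCast,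
      Real.rpow_add_one hβ.ne', Real.rpow_natCast]
    congr 1
    field_simp

theorem sum_pow_div_factorial (x y : ℝ) (N : ℕ) :
    ∑ q ∈ Finset.range (N + 1), x ^ q / q.factorial * (y ^ (N - q) / (N - q).factorial) =
      (x + y) ^ N / N.factorial := by
  rw [add_pow, Finset.sum_div]
  refine Finset.sum_congr rfl fun q hq => ?_
  have hq : q ≤ N := by simpa [Nat.lt_succ_iff] using hq
  have h : (N.factorial : ℝ) = N.choose q * q.factorial * (N - q).factorial := by
    exact_mod_cast (Nat.choose_mul_factorial_mul_factorial hq).symm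
  have hc : (N.choose q : ℝ) ≠ 0 := by exact_mod_cast (Nat.choose_pos hq).ne'
  have : (q.factorial : ℝ) ≠ 0 := by positivity
  have : ((N - q).factorial : ℝ) ≠ 0 := by positivity
  rw [h]
  field_simp

theorem Bond.left_ne_right {L : ℕ} (e : Bond L) : e.left ≠ e.right := by
  intro h
  have := congrArg Subtype.val h
  simp [Bond.left, Bond.right] at this

namespace KMPModel

variable (M : KMPModel)

theorem F_nonneg (n : Config M.L) (ξ : Energy M.L) : 0 ≤ M.F n ξ := by
  have := M.βp_pos
  have := M.βm_pos
  have : ∀ x, 0 < (ξ x : ℝ) := fun x => (ξ x).2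
  exact mul_nonneg (by positivity)
    (Finset.prod_nonneg fun x _ => div_nonneg (pow_nonneg (this x).le _) (by positivity))

theorem measurable_F (n : Config M.L) : Measurable (M.F n) := by
  unfold F
  fun_prop

/-- The product of the factors of the duality function at the sites outside `s`. -/
noncomputable def outsideFactor (s : Finset (Site M.L)) (n : Config M.L) (ξ : Energy M.L) : ℝ :=
  ∏ x ∈ sᶜ, (ξ x : ℝ) ^ n (.site x) / (n (.site x)).factorial

theorem outsideFactor_nonneg (s : Finset (Site M.L)) (n : Config M.L) (ξ : Energy M.L) :
    0 ≤ M.outsideFactor s n ξ :=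
  Finset.prod_nonneg fun x _ => div_nonneg (pow_nonneg (ξ x).2.le _) (by positivity)

theorem outsideFactor_congr {s : Finset (Site M.L)} {n n' : Config M.L} {ξ ξ' : Energy M.L}
    (hn : ∀ x ∉ s, n (.site x) = n' (.site x)) (hξ : ∀ x ∉ s, ξ x = ξ' x) :
    M.outsideFactor s n ξ = M.outsideFactor s n' ξ' :=
  Finset.prod_congr rfl fun x hx => by
    rw [hn x (by simpa using hx), hξ x (by simpa using hx)]

theorem F_eq_pair (n : Config M.L) (ξ : Energy M.L) {x y : Site M.L} (hxy : x ≠ y) :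
    M.F n ξ = 1 / (M.βp ^ n .deltaPlus * M.βm ^ n .deltaMinus) * M.outsideFactor {x, y} n ξ *
      ((ξ x : ℝ) ^ n (.site x) / (n (.site x)).factorial *
        ((ξ y : ℝ) ^ n (.site y) / (n (.site y)).factorial)) := by
  rw [F, outsideFactor, ← Finset.prod_mul_prod_compl {x, y}, Finset.prod_pair hxy]
  ring

theorem F_eq_single (n : Config M.L) (ξ : Energy M.L) (x : Site M.L) :
    M.F n ξ = 1 / (M.βp ^ n .deltaPlus * M.βm ^ n .deltaMinus) * M.outsideFactor {x} n ξ *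
      ((ξ x : ℝ) ^ n (.site x) / (n (.site x)).factorial) := by
  rw [F, outsideFactor, ← Finset.prod_mul_prod_compl {x}, Finset.prod_singleton]
  ring

theorem lintegral_redistributeKernel {L : ℕ} (e : Bond L) {f : Energy L → ℝ≥0∞}
    (hf : Measurable f) (ξ : Energy L) :
    ∫⁻ η, f η ∂redistributeKernel e ξ = ∫⁻ p, f (redistribute e ξ p) ∂unifIoo := by
  rw [redistributeKernel, Kernel.map_apply _ (measurable_redistribute e), Kernel.prod_apply,
    Kernel.id_apply, Kernel.const_apply, Measure.dirac_prod,
    Measure.map_map (measurable_redistribute e) measurable_prodMk_left,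
    lintegral_map hf ((measurable_redistribute e).comp measurable_prodMk_left)]
  rfl

theorem lintegral_reservoirKernel {L : ℕ} (x : Site L) {β : ℝ} (hβ : 0 < β)
    {f : Energy L → ℝ≥0∞} (hf : Measurable f) (ξ : Energy L) :
    ∫⁻ η, f η ∂reservoirKernel x β ξ = ∫⁻ y, f (replaceAt x ξ y) ∂expPos β := by
  have := isProbabilityMeasure_expPos hβ
  rw [reservoirKernel, Kernel.map_apply _ (measurable_replaceAt x), Kernel.prod_apply,
    Kernel.id_apply, Kernel.const_apply, Measure.dirac_prod,
    Measure.map_map (measurable_replaceAt x) measurable_prodMk_left,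
    lintegral_map hf ((measurable_replaceAt x).comp measurable_prodMk_left)]
  rfl

theorem lintegral_shuffleKernel {L : ℕ} (e : Bond L) (f : Config L → ℝ≥0∞) (n : Config L) :
    ∫⁻ m, f m ∂shuffleKernel e n = ∑ q ∈ Finset.range (n (.site e.left) + n (.site e.right) + 1),
      ((n (.site e.left) + n (.site e.right) + 1 : ℕ) : ℝ≥0∞)⁻¹ * f (shuffle e n q) := by
  change ∫⁻ m, f m ∂shuffleMeasure e n = _
  rw [shuffleMeasure, lintegral_finsetSum_measure]
  refine Finset.sum_congr rfl fun q _ => ?_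
  rw [lintegral_smul_measure, lintegral_dirac, smul_eq_mul]

theorem duality_bond (e : Bond M.L) (n : Config M.L) (ξ : Energy M.L) :
    ∫⁻ η, ENNReal.ofReal (M.F n η) ∂redistributeKernel e ξ =
      ∫⁻ m, ENNReal.ofReal (M.F m ξ) ∂shuffleKernel e n := by
  rw [lintegral_redistributeKernel e (M.measurable_F n).ennreal_ofReal, lintegral_shuffleKernel]
  have hlr := e.left_ne_right
  set a := n (.site e.left) with ha
  set b := n (.site e.right) with hb
  have hx : 0 < (ξ e.left : ℝ) := (ξ e.left).2
  have hy : 0 < (ξ e.right : ℝ) := (ξ e.right).2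
  have hβp := M.βp_pos
  have hβm := M.βm_pos
  set R := 1 / (M.βp ^ n .deltaPlus * M.βm ^ n .deltaMinus) *
    M.outsideFactor {e.left, e.right} n ξ with hR
  have hR0 : 0 ≤ R := mul_nonneg (by positivity) (M.outsideFactor_nonneg _ _ _)
  have h1 : ∀ p : Set.Ioo (0 : ℝ) 1, ENNReal.ofReal (M.F n (redistribute e ξ p)) =
      ENNReal.ofReal (R * ((ξ e.left + ξ e.right : ℝ) ^ (a + b) / (a.factorial * b.factorial))) *
        ENNReal.ofReal ((p : ℝ) ^ a * (1 - p) ^ b) := by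
    intro p
    rw [← ENNReal.ofReal_mul (by positivity), M.F_eq_pair n _ hlr,
      M.outsideFactor_congr (n' := n) (ξ' := ξ) (fun _ _ => rfl), ← hR]
    · have hl : (redistribute e ξ p e.left : ℝ) = p * (ξ e.left + ξ e.right) := by
        simp [redistribute, Function.update_of_ne hlr]
      have hr : (redistribute e ξ p e.right : ℝ) = (1 - p) * (ξ e.left + ξ e.right) := by
        simp [redistribute]
      rw [hl, hr, ← ha, ← hb]
      congr 1
      rw [mul_pow, mul_pow, pow_add]
      ring
    · intro x hx
      simp only [Finset.mem_insert, Finset.mem_singleton, not_or] at hx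
      simp [redistribute, Function.update_of_ne hx.1, Function.update_of_ne hx.2]
  have h2 : ∀ q : ℕ, M.F (shuffle e n q) ξ = R * ((ξ e.left : ℝ) ^ q / q.factorial *
      ((ξ e.right : ℝ) ^ (a + b - q) / (a + b - q).factorial)) := by
    intro q
    have hlr' : DualSite.site e.left ≠ DualSite.site e.right := by simpa using hlr
    rw [M.F_eq_pair _ ξ hlr, M.outsideFactor_congr (n' := n) (ξ' := ξ) _ (fun _ _ => rfl)]
    · have hl : shuffle e n q (.site e.left) = q := by
        simp [shuffle, Function.update_of_ne hlr']
      have hr : shuffle e n q (.site e.right) = a + b - q := by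
        simp [shuffle, ha, hb]
      have hp : shuffle e n q .deltaPlus = n .deltaPlus := by simp [shuffle]
      have hm : shuffle e n q .deltaMinus = n .deltaMinus := by simp [shuffle]
      rw [hl, hr, hp, hm]
    · intro x hx
      simp only [Finset.mem_insert, Finset.mem_singleton, not_or] at hx
      simp [shuffle, Function.update_of_ne, hx.1, hx.2]
  simp only [h1, h2]
  have hinv : ((a + b + 1 : ℕ) : ℝ≥0∞)⁻¹ = ENNReal.ofReal (1 / (a + b + 1 : ℕ)) := by
    rw [one_div, ENNReal.ofReal_inv_of_pos (by positivity), ENNReal.ofReal_natCast]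
  rw [lintegral_const_mul' _ _ ENNReal.ofReal_ne_top, lintegral_unifIoo_pow_mul_pow,
    ← ENNReal.ofReal_mul (by positivity), ← Finset.mul_sum, hinv,
    ← ENNReal.ofReal_sum_of_nonneg (fun q _ => by positivity),
    ← ENNReal.ofReal_mul (by positivity), ← Finset.mul_sum, sum_pow_div_factorial]
  congr 1
  have h3 : ((a + b + 1).factorial : ℝ) = (a + b + 1 : ℕ) * (a + b).factorial := by
    exact_mod_cast Nat.factorial_succ _
  have : (0 : ℝ) < a.factorial := by positivity
  have : (0 : ℝ) < b.factorial := by positivity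
  have : (0 : ℝ) < (a + b).factorial := by positivity
  have : (0 : ℝ) < (a + b + 1 : ℕ) := by positivity
  rw [h3]
  field_simp

/-- Averaging `ξ_x ^ n_x / n_x!` over the exponential law of rate `β` gives `1 / β ^ n_x`. -/
theorem lintegral_F_reservoirKernel (x : Site M.L) {β : ℝ} (hβ : 0 < β) (n : Config M.L)
    (ξ : Energy M.L) :
    ∫⁻ η, ENNReal.ofReal (M.F n η) ∂reservoirKernel x β ξ =
      ENNReal.ofReal (1 / (M.βp ^ n .deltaPlus * M.βm ^ n .deltaMinus) *
        M.outsideFactor {x} n ξ * (1 / β ^ n (.site x))) := by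
  have hβp := M.βp_pos
  have hβm := M.βm_pos
  have h0 := M.outsideFactor_nonneg {x} n ξ
  rw [lintegral_reservoirKernel x hβ (M.measurable_F n).ennreal_ofReal,
    ENNReal.ofReal_mul (by positivity), ← lintegral_expPos_pow_div_factorial hβ,
    ← lintegral_const_mul' _ _ ENNReal.ofReal_ne_top]
  refine lintegral_congr fun y => ?_
  rw [← ENNReal.ofReal_mul (by positivity), M.F_eq_single n _ x,
    M.outsideFactor_congr (n' := n) (ξ' := ξ) (fun _ _ => rfl)]
  · simp [replaceAt]
  · intro z hz
    simp [replaceAt, Function.update_of_ne (Finset.notMem_singleton.1 hz)]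

theorem duality_left (n : Config M.L) (ξ : Energy M.L) :
    ∫⁻ η, ENNReal.ofReal (M.F n η) ∂reservoirKernel (Site.first M.L) M.βm ξ =
      ENNReal.ofReal (M.F (absorb (Site.first M.L) .deltaMinus n) ξ) := by
  rw [M.lintegral_F_reservoirKernel _ M.βm_pos, M.F_eq_single _ ξ (Site.first M.L),
    M.outsideFactor_congr (n := absorb (Site.first M.L) .deltaMinus n) (n' := n) (ξ' := ξ) _
      (fun _ _ => rfl)]
  · simp only [absorb, Function.update_self, ne_eq, reduceCtorEq, not_false_eq_true,
      Function.update_of_ne, pow_zero, Nat.factorial_zero, Nat.cast_one, div_one, mul_one, pow_add]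
    congr 1
    ring
  · intro x hx
    have hx := Finset.notMem_singleton.1 hx
    simp [absorb, Function.update_of_ne, hx]

theorem duality_right (n : Config M.L) (ξ : Energy M.L) :
    ∫⁻ η, ENNReal.ofReal (M.F n η) ∂reservoirKernel (Site.last M.L) M.βp ξ =
      ENNReal.ofReal (M.F (absorb (Site.last M.L) .deltaPlus n) ξ) := by
  rw [M.lintegral_F_reservoirKernel _ M.βp_pos, M.F_eq_single _ ξ (Site.last M.L),
    M.outsideFactor_congr (n := absorb (Site.last M.L) .deltaPlus n) (n' := n) (ξ' := ξ) _
      (fun _ _ => rfl)]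
  · simp only [absorb, Function.update_self, ne_eq, reduceCtorEq, not_false_eq_true,
      Function.update_of_ne, pow_zero, Nat.factorial_zero, Nat.cast_one, div_one, mul_one, pow_add]
    congr 1
    ring
  · intro x hx
    have hx := Finset.notMem_singleton.1 hx
    simp [absorb, Function.update_of_ne, hx]

end KMPModel

theorem ClockSystem.lintegral_jumpKernel {S : Type} [MeasurableSpace S] (C : ClockSystem S)
    (f : S → ℝ≥0∞) (x : S) :
    ∫⁻ y, f y ∂C.jumpKernel x =
      ∑ c, ENNReal.ofReal (C.rate c / C.totalRate) * ∫⁻ y, f y ∂C.update c x := by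
  rw [C.jumpKernel_apply, lintegral_finsetSum_measure]
  simp only [lintegral_smul_measure, smul_eq_mul]

namespace KMPModel

variable (M : KMPModel)

theorem duality_update (c : KMPClock M.L) (n : Config M.L) (ξ : Energy M.L) :
    ∫⁻ η, ENNReal.ofReal (M.F n η) ∂M.energyUpdate c ξ =
      ∫⁻ m, ENNReal.ofReal (M.F m ξ) ∂M.walkerUpdate c n := by
  cases c with
  | bond e => exact M.duality_bond e n ξ
  | left =>
    simp only [walkerUpdate, energyUpdate, Kernel.deterministic_apply, lintegral_dirac]
    exact M.duality_left n ξ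
  | right =>
    simp only [walkerUpdate, energyUpdate, Kernel.deterministic_apply, lintegral_dirac]
    exact M.duality_right n ξ

/-- The embedded chains of the KMP process and of the walkers are dual with respect to `F`. -/
theorem duality_jumpKernel (n : Config M.L) (ξ : Energy M.L) :
    ∫⁻ η, ENNReal.ofReal (M.F n η) ∂M.kmp.jumpKernel ξ =
      ∫⁻ m, ENNReal.ofReal (M.F m ξ) ∂M.walkers.jumpKernel n := by
  rw [ClockSystem.lintegral_jumpKernel, ClockSystem.lintegral_jumpKernel]
  exact Finset.sum_congr rfl fun c _ => congrArg _ (M.duality_update c n ξ)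

end KMPModel

/-! ### Absorption of the walkers -/

namespace KMPModel

variable (M : KMPModel)

/-- The sum of the weights `w x` of the particles at the sites `-L, …, L`. -/
noncomputable def weight {L : ℕ} (w : Site L → ℝ) (n : Config L) : ℝ := ∑ x, w x * n (.site x)

theorem weight_one {L : ℕ} (n : Config L) : weight (fun _ => 1) n = size n := by
  simp [weight, size]

theorem weight_shuffle {L : ℕ} (w : Site L → ℝ) (e : Bond L) (n : Config L) {q : ℕ}
    (hq : q ≤ n (.site e.left) + n (.site e.right)) :
    weight w (shuffle e n q) = weight w n - w e.left * n (.site e.left) -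
      w e.right * n (.site e.right) + w e.left * q +
      w e.right * (n (.site e.left) + n (.site e.right) - q) := by
  have hlr := e.left_ne_right
  have hlr' : DualSite.site e.left ≠ DualSite.site e.right := by simpa using hlr
  have h : ∑ x ∈ ({e.left, e.right} : Finset (Site L))ᶜ, w x * shuffle e n q (.site x) =
      ∑ x ∈ ({e.left, e.right} : Finset (Site L))ᶜ, w x * n (.site x) := by
    refine Finset.sum_congr rfl fun x hx => ?_
    simp only [Finset.mem_compl, Finset.mem_insert, Finset.mem_singleton, not_or] at hx
    simp [shuffle, Function.update_of_ne, hx.1, hx.2]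
  have hl : shuffle e n q (.site e.left) = q := by simp [shuffle, Function.update_of_ne hlr']
  have hr : shuffle e n q (.site e.right) = n (.site e.left) + n (.site e.right) - q := by
    simp [shuffle]
  rw [weight, weight, ← Finset.sum_add_sum_compl {e.left, e.right},
    ← Finset.sum_add_sum_compl {e.left, e.right} (fun x => w x * (n (.site x) : ℝ)), h,
    Finset.sum_pair hlr, Finset.sum_pair hlr, hl, hr, Nat.cast_sub hq]
  push_cast
  ring

theorem weight_absorb {L : ℕ} (w : Site L → ℝ) (x : Site L) {d : DualSite L}
    (hd : ∀ y, d ≠ .site y) (n : Config L) :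
    weight w (absorb x d n) = weight w n - w x * n (.site x) := by
  have h : ∑ y ∈ ({x} : Finset (Site L))ᶜ, w y * absorb x d n (.site y) =
      ∑ y ∈ ({x} : Finset (Site L))ᶜ, w y * n (.site y) := by
    refine Finset.sum_congr rfl fun y hy => ?_
    simp only [Finset.mem_compl, Finset.mem_singleton] at hy
    simp [absorb, Function.update_of_ne, hy, (hd y).symm]
  have hx : absorb x d n (.site x) = 0 := by simp [absorb, Function.update_of_ne (hd x).symm]
  rw [weight, weight, ← Finset.sum_add_sum_compl {x},
    ← Finset.sum_add_sum_compl {x} (fun x => w x * (n (.site x) : ℝ)), h, Finset.sum_singleton,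
    Finset.sum_singleton, hx]
  push_cast
  ring

theorem size_shuffle {L : ℕ} (e : Bond L) (n : Config L) {q : ℕ}
    (hq : q ≤ n (.site e.left) + n (.site e.right)) : size (shuffle e n q) = size n := by
  have h := weight_shuffle (fun _ => 1) e n hq
  rw [weight_one, weight_one] at h
  have : (size (shuffle e n q) : ℝ) = size n := by linarith
  exact_mod_cast this

theorem size_absorb {L : ℕ} (x : Site L) {d : DualSite L} (hd : ∀ y, d ≠ .site y)
    (n : Config L) : size (absorb x d n) + n (.site x) = size n := by
  have h := weight_absorb (fun _ => 1) x hd n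
  rw [weight_one, weight_one] at h
  have : (size (absorb x d n) : ℝ) + n (.site x) = size n := by linarith
  exact_mod_cast this

/-- The total number of particles, those at `δ(±)` included. -/
noncomputable def total {L : ℕ} (n : Config L) : ℕ := size n + n .deltaPlus + n .deltaMinus

/-- A property of all the possible outcomes of a ring holds almost surely after a ring. -/
theorem ae_jumpKernel {n : Config M.L} {p : Config M.L → Prop}
    (hb : ∀ e, ∀ q ≤ n (.site e.left) + n (.site e.right), p (shuffle e n q))
    (hl : p (absorb (Site.first M.L) .deltaMinus n))
    (hr : p (absorb (Site.last M.L) .deltaPlus n)) :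
    ∀ᵐ m ∂M.walkers.jumpKernel n, p m := by
  rw [ae_iff, ← lintegral_indicator_one (.of_discrete), ClockSystem.lintegral_jumpKernel]
  refine Finset.sum_eq_zero fun c _ => mul_eq_zero_of_right _ ?_
  change ∫⁻ m, _ ∂M.walkerUpdate c n = 0
  cases c with
  | bond e =>
    refine (lintegral_shuffleKernel e _ n).trans (Finset.sum_eq_zero fun q hq => ?_)
    have hq : q ≤ n (.site e.left) + n (.site e.right) := by
      simpa [Nat.lt_succ_iff] using hq
    simp [hb e q hq]
  | left => simp [walkerUpdate, hl]
  | right => simp [walkerUpdate, hr]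

theorem ae_jumpKernel_total (n : Config M.L) :
    ∀ᵐ m ∂M.walkers.jumpKernel n, total m = total n := by
  refine M.ae_jumpKernel (fun e q hq => ?_) ?_ ?_
  · rw [total, size_shuffle e n hq]
    simp [shuffle, total]
  · have := size_absorb (Site.first M.L) (d := .deltaMinus) (by simp) n
    simp only [total, absorb, Function.update_self, ne_eq, reduceCtorEq, not_false_eq_true,
      Function.update_of_ne] at this ⊢
    omega
  · have := size_absorb (Site.last M.L) (d := .deltaPlus) (by simp) n
    simp only [total, absorb, Function.update_self, ne_eq, reduceCtorEq, not_false_eq_true,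
      Function.update_of_ne] at this ⊢
    omega

/-- The configurations of `N` particles with `j` of them at `δ(+)` and the others at `δ(-)`. -/
def absorbed (L N j : ℕ) : Set (Config L) := {n | size n = 0 ∧ n .deltaPlus = j ∧ total n = N}

theorem site_eq_zero {L : ℕ} {n : Config L} (h : size n = 0) (x : Site L) : n (.site x) = 0 :=
  Finset.sum_eq_zero_iff.1 h x (Finset.mem_univ x)

theorem jumpKernel_absorbed_compl (N j : ℕ) :
    ∀ n ∈ absorbed M.L N j, M.walkers.jumpKernel n (absorbed M.L N j)ᶜ = 0 := by
  rintro n ⟨hs, hj, hN⟩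
  have h0 := site_eq_zero hs
  have h : ∀ᵐ m ∂M.walkers.jumpKernel n, size m = 0 ∧ m .deltaPlus = j := by
    refine M.ae_jumpKernel (fun e q hq => ?_) ?_ ?_
    · rw [size_shuffle e n hq]
      exact ⟨hs, by simpa [shuffle] using hj⟩
    · have := size_absorb (Site.first M.L) (d := .deltaMinus) (by simp) n
      exact ⟨by omega, by simpa [absorb] using hj⟩
    · have := size_absorb (Site.last M.L) (d := .deltaPlus) (by simp) n
      exact ⟨by omega, by simpa [absorb, h0] using hj⟩
  have h' : ∀ᵐ m ∂M.walkers.jumpKernel n, m ∈ absorbed M.L N j := by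
    filter_upwards [h, M.ae_jumpKernel_total n] with m hm hm'
    exact ⟨hm.1, hm.2, hm'.trans hN⟩
  exact h'

/-- The number of particles is conserved. -/
theorem ae_chainLaw_total (k : Config M.L) :
    ∀ᵐ Y ∂M.walkers.chainLaw k, ∀ m, total (Y m) = total k := by
  have h : ∀ n ∈ {n : Config M.L | total n = total k},
      M.walkers.jumpKernel n {n : Config M.L | total n = total k}ᶜ = 0 := by
    intro n hn
    have : ∀ᵐ m ∂M.walkers.jumpKernel n, total m = total k := by
      filter_upwards [M.ae_jumpKernel_total n] with m hm
      exact hm.trans hn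
    exact this
  filter_upwards [M.walkers.ae_chainLaw_absorbing (.of_discrete) h k,
    M.walkers.ae_chainLaw_zero k] with Y hY h0 m
  induction m with
  | zero => rw [h0]
  | succ m ih => exact hY m ih

theorem ae_chainDist_total (k : Config M.L) (m : ℕ) :
    ∀ᵐ n ∂M.walkers.chainDist m k, total n = total k := by
  rw [ClockSystem.chainDist_apply]
  refine (ae_map_iff (measurable_pi_apply m).aemeasurable (.of_discrete)).2 ?_
  filter_upwards [M.ae_chainLaw_total k] with Y hY using hY m

/-! ### A Lyapunov function for the walkers -/

/-- Summation by parts for the linear coefficients `L - x`. -/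
theorem sum_Ico_mul_sub (L : ℕ) (f : ℤ → ℝ) :
    ∑ x ∈ Finset.Ico (-(L : ℤ)) L, ((L : ℝ) - x) * (f x - f (x + 1)) =
      (2 * L + 1) * f (-L) - ∑ x ∈ Finset.Icc (-(L : ℤ)) L, f x := by
  have key : ∀ m : ℕ, ∑ i ∈ Finset.range m, ((2 * L : ℝ) - i) *
      (f (-L + i) - f (-L + i + 1)) = (2 * L + 1) * f (-L) -
        ∑ i ∈ Finset.range m, f (-L + i) - (2 * L - m + 1) * f (-L + m) := by
    intro m
    induction m with
    | zero => simp
    | succ m ih =>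
      rw [Finset.sum_range_succ, ih, Finset.sum_range_succ]
      push_cast
      rw [add_assoc (-(L : ℤ))]
      ring
  have h1 : ∀ g : ℤ → ℝ, ∑ x ∈ Finset.Ico (-(L : ℤ)) L, g x =
      ∑ i ∈ Finset.range (2 * L), g (-L + i) := by
    intro g
    symm
    refine Finset.sum_nbij' (fun i : ℕ => -(L : ℤ) + i) (fun x : ℤ => (x + L).toNat)
      ?_ ?_ ?_ ?_ ?_
    · intro i hi
      simp only [Finset.mem_range, Finset.mem_Ico] at hi ⊢
      omega
    · intro x hx
      simp only [Finset.mem_range, Finset.mem_Ico] at hx ⊢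
      omega
    · intro i _
      simp
    · intro x hx
      simp only [Finset.mem_Ico] at hx
      omega
    · intro i _
      rfl
  have h2 : Finset.Icc (-(L : ℤ)) L = insert (L : ℤ) (Finset.Ico (-(L : ℤ)) L) := by
    rw [Finset.Ico_insert_right (by omega)]
  rw [h2, Finset.sum_insert (by simp), h1, h1]
  have h := key (2 * L)
  have hL : -(L : ℤ) + (2 * L : ℕ) = L := by push_cast; ring
  rw [hL] at h
  push_cast at h ⊢
  rw [show (2 * L - 2 * L + 1 : ℝ) = 1 by ring] at h
  rw [add_comm (f L), ← sub_sub, ← one_mul (f L), ← h]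
  refine Finset.sum_congr rfl fun i _ => ?_
  ring

theorem sum_bond {L : ℕ} (n : Config L) :
    ∑ e : Bond L, ((L : ℝ) - (e.1 : ℤ)) * (n (.site e.left) - n (.site e.right)) =
      (2 * L + 1) * n (.site (Site.first L)) - size n := by
  let f : ℤ → ℝ := fun x =>
    if h : x ∈ Finset.Icc (-(L : ℤ)) L then (n (.site ⟨x, h⟩) : ℝ) else 0
  have hf : ∀ x : Site L, f x.1 = n (.site x) := fun x => dif_pos x.2
  have h := sum_Ico_mul_sub L f
  rw [← Finset.sum_coe_sort (Finset.Icc (-(L : ℤ)) L), ← Finset.sum_coe_sort] at h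
  have hs : (size n : ℝ) = ∑ x : Site L, f x.1 := by simp [size, hf]
  rw [hs, ← hf (Site.first L)]
  refine Eq.trans (Finset.sum_congr rfl fun e _ => ?_) h
  rw [← hf e.left, ← hf e.right]
  rfl

/-- The weights of the Lyapunov function: with the reflecting boundary conditions and an additional
killing at rate `A / L ^ a` at `-L`, half the discrete Laplacian of these weights is the
constant `-1`. -/
noncomputable def lyapunovWeight (x : Site M.L) : ℝ :=
  (2 * M.L + 1) / M.rate .left + ((x.1 : ℝ) + M.L) * (3 * M.L + 1 - x.1)

theorem lyapunovWeight_nonneg (x : Site M.L) : 0 ≤ M.lyapunovWeight x := by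
  have hx := Finset.mem_Icc.1 x.2
  have h1 : (-(M.L : ℝ)) ≤ (x.1 : ℝ) := by exact_mod_cast hx.1
  have h2 : (x.1 : ℝ) ≤ M.L := by exact_mod_cast hx.2
  have := M.rate_pos .left
  have h3 : 0 ≤ (x.1 : ℝ) + M.L := by linarith
  have h4 : 0 ≤ 3 * (M.L : ℝ) + 1 - x.1 := by linarith
  unfold lyapunovWeight
  positivity

theorem lyapunovWeight_right_sub_left (e : Bond M.L) :
    M.lyapunovWeight e.right - M.lyapunovWeight e.left = 2 * (M.L - (e.1 : ℤ)) := by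
  simp only [lyapunovWeight, Bond.right, Bond.left]
  push_cast
  ring

theorem rate_left_mul_lyapunovWeight_first :
    M.rate .left * M.lyapunovWeight (Site.first M.L) = 2 * M.L + 1 := by
  have := (M.rate_pos .left).ne'
  simp only [lyapunovWeight, Site.first]
  push_cast
  field_simp
  ring

/-- The mean of `weight w` after a ring of the clock `c`. -/
noncomputable def meanWeight (w : Site M.L → ℝ) (n : Config M.L) : KMPClock M.L → ℝ
  | .bond e => weight w n +
      (w e.right - w e.left) * (n (.site e.left) - n (.site e.right)) / 2
  | .left => weight w n - w (Site.first M.L) * n (.site (Site.first M.L))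
  | .right => weight w n - w (Site.last M.L) * n (.site (Site.last M.L))

theorem weight_nonneg {L : ℕ} {w : Site L → ℝ} (hw : ∀ x, 0 ≤ w x) (n : Config L) :
    0 ≤ weight w n :=
  Finset.sum_nonneg fun x _ => mul_nonneg (hw x) (Nat.cast_nonneg _)

theorem mean_weight_shuffle (w : Site M.L → ℝ) (n : Config M.L) (e : Bond M.L) :
    1 / ((n (.site e.left) + n (.site e.right) + 1 : ℕ) : ℝ) *
      ∑ q ∈ Finset.range (n (.site e.left) + n (.site e.right) + 1), weight w (shuffle e n q) =
        M.meanWeight w n (.bond e) := by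
  rw [meanWeight]
  set a := n (.site e.left) with ha
  set b := n (.site e.right) with hb
  have h : ∑ q ∈ Finset.range (a + b + 1), weight w (shuffle e n q) =
      ∑ q ∈ Finset.range (a + b + 1), ((weight w n - w e.left * a - w e.right * b +
        w e.right * (a + b)) + (w e.left - w e.right) * q) := by
    refine Finset.sum_congr rfl fun q hq => ?_
    rw [weight_shuffle w e n (by simpa [Nat.lt_succ_iff] using hq)]
    ring
  have hg : (∑ q ∈ Finset.range (a + b + 1), (q : ℝ)) = (a + b + 1) * (a + b) / 2 := by
    have := congrArg (Nat.cast : ℕ → ℝ) (Finset.sum_range_id_mul_two (a + b + 1))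
    rw [Nat.add_sub_cancel] at this
    push_cast at this
    linarith
  rw [h, Finset.sum_add_distrib, ← Finset.mul_sum, hg]
  simp only [Finset.sum_const, Finset.card_range, nsmul_eq_mul]
  push_cast
  have : (a + b + 1 : ℝ) ≠ 0 := by positivity
  field_simp
  ring

theorem meanWeight_nonneg {w : Site M.L → ℝ} (hw : ∀ x, 0 ≤ w x) (n : Config M.L)
    (c : KMPClock M.L) : 0 ≤ M.meanWeight w n c := by
  cases c with
  | bond e =>
    rw [← mean_weight_shuffle]
    exact mul_nonneg (by positivity) (Finset.sum_nonneg fun q _ => weight_nonneg hw _)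
  | left =>
    rw [meanWeight, ← weight_absorb w _ (d := .deltaMinus) (by simp)]
    exact weight_nonneg hw _
  | right =>
    rw [meanWeight, ← weight_absorb w _ (d := .deltaPlus) (by simp)]
    exact weight_nonneg hw _

theorem lintegral_weight_walkerUpdate {w : Site M.L → ℝ} (hw : ∀ x, 0 ≤ w x) (n : Config M.L)
    (c : KMPClock M.L) :
    ∫⁻ m, ENNReal.ofReal (weight w m) ∂M.walkerUpdate c n =
      ENNReal.ofReal (M.meanWeight w n c) := by
  cases c with
  | bond e =>
    refine (lintegral_shuffleKernel e _ n).trans ?_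
    rw [← mean_weight_shuffle, ← Finset.mul_sum,
      ← ENNReal.ofReal_sum_of_nonneg fun q _ => weight_nonneg hw _,
      ENNReal.ofReal_mul (by positivity), one_div, ENNReal.ofReal_inv_of_pos (by positivity),
      ENNReal.ofReal_natCast]
  | left =>
    simp only [walkerUpdate, Kernel.deterministic_apply, lintegral_dirac, meanWeight]
    rw [weight_absorb w _ (by simp)]
  | right =>
    simp only [walkerUpdate, Kernel.deterministic_apply, lintegral_dirac, meanWeight]
    rw [weight_absorb w _ (by simp)]

/-- The generator decreases the Lyapunov function at least by the number of the particles that are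
not yet absorbed. -/
theorem sum_rate_mul_meanWeight_le (n : Config M.L) :
    ∑ c, M.rate c * M.meanWeight M.lyapunovWeight n c + size n ≤
      (∑ c, M.rate c) * weight M.lyapunovWeight n := by
  have h1 := sum_bond n
  have h2 : ∑ e : Bond M.L, M.meanWeight M.lyapunovWeight n (.bond e) =
      ∑ e : Bond M.L, weight M.lyapunovWeight n +
        ∑ e : Bond M.L, ((M.L : ℝ) - (e.1 : ℤ)) * (n (.site e.left) - n (.site e.right)) := by
    rw [← Finset.sum_add_distrib]
    refine Finset.sum_congr rfl fun e _ => ?_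
    rw [meanWeight, lyapunovWeight_right_sub_left]
    ring
  have h3 := M.rate_left_mul_lyapunovWeight_first
  have h4 : 0 ≤ M.rate .right * (M.lyapunovWeight (Site.last M.L) *
      n (.site (Site.last M.L))) :=
    mul_nonneg (M.rate_pos _).le (mul_nonneg (M.lyapunovWeight_nonneg _) (Nat.cast_nonneg _))
  rw [KMPClock.sum_eq, KMPClock.sum_eq]
  have h5 : ∀ e : Bond M.L, M.rate (.bond e) = 1 := fun _ => rfl
  simp only [h5, one_mul]
  rw [h2, h1, add_mul (_ + _), add_mul (∑ _, _), Finset.sum_mul]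
  simp only [one_mul, meanWeight]
  have h6 : M.rate .left * (M.lyapunovWeight (Site.first M.L) * n (.site (Site.first M.L))) =
      (2 * M.L + 1) * n (.site (Site.first M.L)) := by rw [← mul_assoc, h3]
  linarith

theorem lintegral_jumpKernel_weight_add_le (n : Config M.L) :
    ∫⁻ m, ENNReal.ofReal (weight M.lyapunovWeight m) ∂M.walkers.jumpKernel n +
      ENNReal.ofReal (1 / M.walkers.totalRate) * size n ≤
        ENNReal.ofReal (weight M.lyapunovWeight n) := by
  have hr : ∀ c, 0 < M.rate c := M.rate_pos
  have hlam : 0 < ∑ c, M.rate c := M.walkers.totalRate_pos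
  have hpos := M.meanWeight_nonneg M.lyapunovWeight_nonneg n
  rw [ClockSystem.lintegral_jumpKernel]
  change ∑ c : KMPClock M.L, ENNReal.ofReal (M.rate c / ∑ c, M.rate c) *
    ∫⁻ m, _ ∂M.walkerUpdate c n + ENNReal.ofReal (1 / ∑ c, M.rate c) * _ ≤ _
  simp only [M.lintegral_weight_walkerUpdate M.lyapunovWeight_nonneg]
  have h : ∀ c : KMPClock M.L, ENNReal.ofReal (M.rate c / ∑ c, M.rate c) *
      ENNReal.ofReal (M.meanWeight M.lyapunovWeight n c) =
      ENNReal.ofReal (1 / (∑ c, M.rate c) * (M.rate c * M.meanWeight M.lyapunovWeight n c)) := by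
    intro c
    rw [← ENNReal.ofReal_mul (div_pos (hr c) hlam).le]
    congr 1
    ring
  rw [Finset.sum_congr rfl fun c _ => h c, ← ENNReal.ofReal_sum_of_nonneg fun c _ =>
    mul_nonneg (by positivity) (mul_nonneg (hr c).le (hpos c)), ← ENNReal.ofReal_natCast,
    ← ENNReal.ofReal_mul (by positivity), ← ENNReal.ofReal_add
      (Finset.sum_nonneg fun c _ => mul_nonneg (by positivity) (mul_nonneg (hr c).le (hpos c)))
      (by positivity), ← Finset.mul_sum, ← mul_add]
  refine ENNReal.ofReal_le_ofReal ?_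
  rw [one_div, inv_mul_le_iff₀ hlam]
  exact M.sum_rate_mul_meanWeight_le n

/-- The expected number of particles not yet absorbed tends to `0`: its sum over the steps of the
embedded chain is bounded by the initial value of the Lyapunov function. -/
theorem tendsto_lintegral_size (k : Config M.L) :
    Tendsto (fun m => ∫⁻ n, (size n : ℝ≥0∞) ∂M.walkers.chainDist m k) atTop (𝓝 0) := by
  set C := M.walkers with hC
  set c := ENNReal.ofReal (1 / C.totalRate) with hc
  have hc0 : c ≠ 0 := by
    have := C.totalRate_pos
    simpa [hc] using this
  set W : Config M.L → ℝ≥0∞ := fun n => ENNReal.ofReal (weight M.lyapunovWeight n) with hW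
  have hstep : ∀ m, ∫⁻ n, W n ∂C.chainDist (m + 1) k +
      c * ∫⁻ n, (size n : ℝ≥0∞) ∂C.chainDist m k ≤ ∫⁻ n, W n ∂C.chainDist m k := by
    intro m
    rw [C.chainDist_succ, Kernel.lintegral_comp _ _ _ (.of_discrete),
      ← lintegral_const_mul' _ _ ENNReal.ofReal_ne_top, ← lintegral_add_left (.of_discrete)]
    exact lintegral_mono fun n => M.lintegral_jumpKernel_weight_add_le n
  have hsum : ∀ m, ∫⁻ n, W n ∂C.chainDist m k +
      ∑ i ∈ Finset.range m, c * ∫⁻ n, (size n : ℝ≥0∞) ∂C.chainDist i k ≤ W k := by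
    intro m
    induction m with
    | zero => simp [C.chainDist_zero, Kernel.id_apply]
    | succ m ih =>
      refine le_trans ?_ ih
      rw [Finset.sum_range_succ, add_comm (∑ i ∈ Finset.range m, _), ← add_assoc]
      gcongr
      exact hstep m
  have htsum : ∑' i, c * ∫⁻ n, (size n : ℝ≥0∞) ∂C.chainDist i k ≠ ∞ := by
    refine ne_top_of_le_ne_top (b := W k) ENNReal.ofReal_ne_top ?_
    rw [ENNReal.tsum_eq_iSup_nat]
    exact iSup_le fun m => le_add_self.trans (hsum m)
  have h := ENNReal.tendsto_atTop_zero_of_tsum_ne_top htsum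
  have h' := ENNReal.Tendsto.const_mul (a := c⁻¹) h (Or.inr (ENNReal.inv_ne_top.2 hc0))
  rw [mul_zero] at h'
  refine h'.congr fun m => ?_
  rw [← mul_assoc, ENNReal.inv_mul_cancel hc0 ENNReal.ofReal_ne_top, one_mul]

theorem tendsto_chainDist_size_ne_zero (k : Config M.L) :
    Tendsto (fun m => M.walkers.chainDist m k {n | size n ≠ 0}) atTop (𝓝 0) := by
  refine tendsto_of_tendsto_of_tendsto_of_le_of_le tendsto_const_nhds (M.tendsto_lintegral_size k)
    (fun _ => zero_le) fun m => ?_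
  rw [← lintegral_indicator_one (.of_discrete)]
  refine lintegral_mono fun n => ?_
  by_cases h : size n = 0
  · simp [h]
  · have : (1 : ℝ≥0∞) ≤ size n := by exact_mod_cast Nat.one_le_iff_ne_zero.2 h
    simpa [h] using this

end KMPModel

/-! ### Limits along the dual chain -/

namespace KMPModel

variable (M : KMPModel)

/-- The probability that the walkers started from `k` end up with exactly `j` particles at `δ(+)`
and all the others at `δ(-)`. -/
noncomputable def absorptionProb (k : Config M.L) (j : ℕ) : ℝ≥0∞ :=
  M.walkers.chainLaw k {Y | ∃ m, Y m ∈ absorbed M.L (total k) j}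

/-- The value of the duality function at a configuration of `absorbed M.L N j`. -/
noncomputable def absorbedValue (N j : ℕ) : ℝ≥0∞ :=
  ENNReal.ofReal (1 / (M.βp ^ j * M.βm ^ (N - j)))

theorem finite_total_eq (L N : ℕ) : {n : Config L | total n = N}.Finite := by
  refine (Set.finite_Iic (fun _ : DualSite L => N)).subset fun n hn => Set.mem_Iic.2 fun d => ?_
  have hn : size n + n .deltaPlus + n .deltaMinus = N := hn
  cases d with
  | deltaMinus => change n .deltaMinus ≤ N; omega
  | deltaPlus => change n .deltaPlus ≤ N; omega
  | site x =>
    have : n (.site x) ≤ size n :=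
      Finset.single_le_sum (f := fun x => n (.site x)) (fun _ _ => Nat.zero_le _)
        (Finset.mem_univ x)
    change n (.site x) ≤ N
    omega

/-- As all the particles are eventually absorbed, the mean of `φ` along the dual chain converges to
its mean over the absorbed configurations. -/
theorem tendsto_lintegral_chainDist (k : Config M.L) (φ : Config M.L → ℝ≥0∞) (c : ℕ → ℝ≥0∞)
    (hφ : ∀ n, total n = total k → φ n ≠ ∞) (hc : ∀ j ≤ total k, c j ≠ ∞)
    (hφc : ∀ j ≤ total k, ∀ n ∈ absorbed M.L (total k) j, φ n = c j) :
    Tendsto (fun m => ∫⁻ n, φ n ∂M.walkers.chainDist m k) atTop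
      (𝓝 (∑ j ∈ Finset.range (total k + 1), c j * M.absorptionProb k j)) := by
  set N := total k with hN
  have hdecomp : ∀ m, ∫⁻ n, φ n ∂M.walkers.chainDist m k =
      ∑ j ∈ Finset.range (N + 1), c j * M.walkers.chainDist m k (absorbed M.L N j) +
        ∫⁻ n in {n | size n ≠ 0}, φ n ∂M.walkers.chainDist m k := by
    intro m
    have h : ∀ j, c j * M.walkers.chainDist m k (absorbed M.L N j) =
        ∫⁻ n, (absorbed M.L N j).indicator (fun _ => c j) n ∂M.walkers.chainDist m k := fun j =>
      (lintegral_indicator_const (.of_discrete) _).symm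
    rw [Finset.sum_congr rfl fun j _ => h j, ← lintegral_finsetSum _ fun j _ => .of_discrete,
      ← lintegral_indicator (.of_discrete), ← lintegral_add_left (.of_discrete)]
    refine lintegral_congr_ae ?_
    filter_upwards [M.ae_chainDist_total k m] with n hn
    have hn' : size n + n .deltaPlus + n .deltaMinus = N := hn
    by_cases hs : size n = 0
    · have hj : n .deltaPlus ≤ N := by omega
      have hmem : n ∈ absorbed M.L N (n .deltaPlus) := ⟨hs, rfl, hn⟩
      rw [Finset.sum_eq_single (n .deltaPlus), Set.indicator_of_mem hmem,
        Set.indicator_of_notMem (by simpa using hs), add_zero, hφc _ hj n hmem]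
      · intro j _ hne
        exact Set.indicator_of_notMem (fun h => hne h.2.1.symm) _
      · intro h
        exact absurd (Finset.mem_range.2 (Nat.lt_succ_of_le hj)) h
    · rw [Finset.sum_eq_zero, zero_add, Set.indicator_of_mem (by simpa using hs)]
      intro j _
      exact Set.indicator_of_notMem (fun h => hs h.1) _
  simp only [hdecomp]
  rw [← add_zero (∑ j ∈ Finset.range (N + 1), c j * M.absorptionProb k j)]
  refine Tendsto.add (tendsto_finsetSum _ fun j hj => ?_) ?_
  · refine ENNReal.Tendsto.const_mul ?_
      (Or.inr (hc j (Nat.lt_succ_iff.1 (Finset.mem_range.1 hj))))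
    exact M.walkers.tendsto_chainDist_absorbing (.of_discrete)
      (M.jumpKernel_absorbed_compl N j) k
  · set B := ∑ n ∈ (finite_total_eq M.L N).toFinset, φ n with hB
    have hBtop : B ≠ ∞ := ENNReal.sum_ne_top.2 fun n hn => hφ n (by simpa using hn)
    have hlim := ENNReal.Tendsto.const_mul (a := B) (M.tendsto_chainDist_size_ne_zero k)
      (Or.inr hBtop)
    rw [mul_zero] at hlim
    refine tendsto_of_tendsto_of_tendsto_of_le_of_le tendsto_const_nhds hlim (fun _ => zero_le)
      fun m => ?_
    dsimp only
    rw [← setLIntegral_const]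
    refine setLIntegral_mono_ae measurable_const.aemeasurable ?_
    filter_upwards [M.ae_chainDist_total k m] with n hn _
    exact Finset.single_le_sum (f := φ) (fun _ _ => zero_le) (by simpa using hn)

theorem ofReal_F_of_mem_absorbed {N j : ℕ} {n : Config M.L} (hn : n ∈ absorbed M.L N j)
    (ξ : Energy M.L) : ENNReal.ofReal (M.F n ξ) = M.absorbedValue N j := by
  obtain ⟨hs, hj, hN⟩ := hn
  have hN : size n + n .deltaPlus + n .deltaMinus = N := hN
  have hm : n .deltaMinus = N - j := by omega
  simp [F, absorbedValue, site_eq_zero hs, hj, hm]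

theorem tendsto_lintegral_F_chainDist (k : Config M.L) (ξ : Energy M.L) :
    Tendsto (fun m => ∫⁻ n, ENNReal.ofReal (M.F n ξ) ∂M.walkers.chainDist m k) atTop
      (𝓝 (∑ j ∈ Finset.range (total k + 1), M.absorbedValue (total k) j *
        M.absorptionProb k j)) :=
  M.tendsto_lintegral_chainDist k _ _ (fun _ _ => ENNReal.ofReal_ne_top)
    (fun _ _ => ENNReal.ofReal_ne_top) fun _ _ _ hn => M.ofReal_F_of_mem_absorbed hn ξ

/-! ### Moments of the invariant measure -/

theorem measurable_uncurry_F :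
    Measurable fun z : Energy M.L × Config M.L => ENNReal.ofReal (M.F z.2 z.1) :=
  measurable_from_prod_countable_left fun n => (M.measurable_F n).ennreal_ofReal

/-- Duality at step `m` of the embedded chains. -/
theorem duality_chainDist (m : ℕ) (n : Config M.L) (ξ : Energy M.L) :
    ∫⁻ η, ENNReal.ofReal (M.F n η) ∂M.kmp.chainDist m ξ =
      ∫⁻ n', ENNReal.ofReal (M.F n' ξ) ∂M.walkers.chainDist m n := by
  induction m generalizing n with
  | zero =>
    rw [ClockSystem.chainDist_zero, ClockSystem.chainDist_zero, Kernel.id_apply, Kernel.id_apply,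
      lintegral_dirac' _ (M.measurable_F n).ennreal_ofReal, lintegral_dirac]
  | succ m ih =>
    rw [M.kmp.chainDist_succ, M.walkers.chainDist_succ',
      Kernel.lintegral_comp _ _ _ (M.measurable_F n).ennreal_ofReal,
      Kernel.lintegral_comp _ _ _ (.of_discrete)]
    simp only [M.duality_jumpKernel, ← ih]
    exact lintegral_lintegral_swap M.measurable_uncurry_F.aemeasurable

theorem lintegral_eq_of_invariant {S : Type} [MeasurableSpace S] {κ : Kernel S S} {μ : Measure S}
    (h : κ.Invariant μ) {f : S → ℝ≥0∞} (hf : Measurable f) :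
    ∫⁻ x, f x ∂μ = ∫⁻ x, ∫⁻ y, f y ∂κ x ∂μ := by
  conv_lhs => rw [← h.def]
  exact Measure.lintegral_bind κ.aemeasurable hf.aemeasurable

/-- Duality gives the convergence of `K ^ m F(k, ·)` only pointwise; truncating at level `R` makes
the convergence dominated, whence the finiteness of the moments. -/
theorem lintegral_F_le {μ : Measure (Energy M.L)} [IsProbabilityMeasure μ]
    (hμ : M.kmp.jumpKernel.Invariant μ) (k : Config M.L) :
    ∫⁻ ξ, ENNReal.ofReal (M.F k ξ) ∂μ ≤
      ∑ j ∈ Finset.range (total k + 1), M.absorbedValue (total k) j * M.absorptionProb k j := by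
  set h := ∑ j ∈ Finset.range (total k + 1), M.absorbedValue (total k) j * M.absorptionProb k j
  have hf := (M.measurable_F k).ennreal_ofReal
  have hR : ∀ R : ℕ, ∫⁻ ξ, min (ENNReal.ofReal (M.F k ξ)) R ∂μ ≤ h := by
    intro R
    have hle : ∀ m, ∫⁻ ξ, min (ENNReal.ofReal (M.F k ξ)) R ∂μ ≤
        ∫⁻ ξ, min (∫⁻ n, ENNReal.ofReal (M.F n ξ) ∂M.walkers.chainDist m k) R ∂μ := by
      intro m
      rw [lintegral_eq_of_invariant (M.kmp.invariant_chainDist hμ m) (hf.min measurable_const)]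
      refine lintegral_mono fun ξ => le_min ?_ ?_
      · rw [← M.duality_chainDist]
        exact lintegral_mono fun η => min_le_left _ _
      · refine (lintegral_mono fun η => min_le_right _ _).trans ?_
        simp
    have hlim : Tendsto (fun m => ∫⁻ ξ, min (∫⁻ n, ENNReal.ofReal (M.F n ξ)
        ∂M.walkers.chainDist m k) R ∂μ) atTop (𝓝 (∫⁻ _, min h R ∂μ)) := by
      refine tendsto_lintegral_of_dominated_convergence (fun _ => (R : ℝ≥0∞)) (fun m => ?_)
        (fun m => .of_forall fun ξ => min_le_right _ _) (by simp)
        (.of_forall fun ξ => (M.tendsto_lintegral_F_chainDist k ξ).min tendsto_const_nhds)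
      refine Measurable.min ?_ measurable_const
      simp only [← M.duality_chainDist]
      exact hf.lintegral_kernel
    refine (ge_of_tendsto' hlim hle).trans ?_
    simp
  have hsup : ∀ ξ, ⨆ R : ℕ, min (ENNReal.ofReal (M.F k ξ)) R = ENNReal.ofReal (M.F k ξ) := by
    intro ξ
    refine le_antisymm (iSup_le fun R => min_le_left _ _) ?_
    obtain ⟨R, hR⟩ := ENNReal.exists_nat_gt (ENNReal.ofReal_ne_top (r := M.F k ξ))
    exact le_iSup_of_le R (le_min le_rfl hR.le)
  rw [← lintegral_congr hsup, lintegral_iSup (fun R => hf.min measurable_const)]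
  · exact iSup_le hR
  · intro R R' hRR' ξ
    exact min_le_min le_rfl (by exact_mod_cast hRR')

theorem sum_absorbedValue_mul_ne_top (k : Config M.L) :
    ∑ j ∈ Finset.range (total k + 1), M.absorbedValue (total k) j * M.absorptionProb k j ≠ ∞ :=
  ENNReal.sum_ne_top.2 fun _ _ => ENNReal.mul_ne_top ENNReal.ofReal_ne_top (measure_ne_top _ _)

/-- The moments of an invariant probability measure, seen as a function of `k`, are harmonic for
the dual chain, hence equal to the mean of their values at the absorbed configurations. -/
theorem lintegral_F_eq {μ : Measure (Energy M.L)} [IsProbabilityMeasure μ]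
    (hμ : M.kmp.jumpKernel.Invariant μ) (k : Config M.L) :
    ∫⁻ ξ, ENNReal.ofReal (M.F k ξ) ∂μ =
      ∑ j ∈ Finset.range (total k + 1), M.absorbedValue (total k) j * M.absorptionProb k j := by
  have hharm : ∀ m, ∫⁻ n, ∫⁻ ξ, ENNReal.ofReal (M.F n ξ) ∂μ ∂M.walkers.chainDist m k =
      ∫⁻ ξ, ENNReal.ofReal (M.F k ξ) ∂μ := by
    intro m
    rw [lintegral_eq_of_invariant (M.kmp.invariant_chainDist hμ m)
      (M.measurable_F k).ennreal_ofReal]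
    simp only [M.duality_chainDist]
    exact (lintegral_lintegral_swap M.measurable_uncurry_F.aemeasurable).symm
  have hlim := M.tendsto_lintegral_chainDist k (fun n => ∫⁻ ξ, ENNReal.ofReal (M.F n ξ) ∂μ)
    (M.absorbedValue (total k))
    (fun n _ => ne_top_of_le_ne_top (M.sum_absorbedValue_mul_ne_top n) (M.lintegral_F_le hμ n))
    (fun _ _ => ENNReal.ofReal_ne_top)
    (fun j _ n hn => by simp [M.ofReal_F_of_mem_absorbed hn])
  simp only [hharm] at hlim
  exact tendsto_nhds_unique tendsto_const_nhds hlim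

/-! ### The hitting probabilities of the dual process -/

/-- The process in continuous time visits exactly the states of its embedded chain. -/
theorem hitProb_eq (k : Config M.L) (hm : k .deltaMinus = 0) (hp : k .deltaPlus = 0) {j : ℕ}
    (hj : j ≤ size k) : M.hitProb k j = (M.absorptionProb k j).toReal := by
  have htot : total k = size k := by simp [total, hm, hp]
  rw [hitProb, measureReal_def, absorptionProb]
  congr 1
  have hfst : M.walkers.chainLaw k {Y | ∃ m, Y m ∈ absorbed M.L (total k) j} =
      M.walkers.law k {ω | ∃ m, ω.1 m ∈ absorbed M.L (total k) j} := by
    have h : {ω : (ℕ → Config M.L) × (ℕ → ℝ) | ∃ m, ω.1 m ∈ absorbed M.L (total k) j} =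
        {Y | ∃ m, Y m ∈ absorbed M.L (total k) j} ×ˢ Set.univ := by
      ext ω
      simp
    rw [h, ClockSystem.law_apply, Measure.prod_prod, measure_univ, mul_one]
  rw [hfst]
  refine measure_congr ?_
  have htotal : ∀ᵐ ω ∂M.walkers.law k, ∀ m, total (ω.1 m) = total k := by
    rw [ClockSystem.law_apply]
    exact Measure.quasiMeasurePreserving_fst.ae (M.ae_chainLaw_total k)
  have hpos : ∀ᵐ ω ∂M.walkers.law k, ∀ i, 0 < ω.2 i := by
    rw [ClockSystem.law_apply]
    exact Measure.quasiMeasurePreserving_snd.ae M.walkers.ae_timesLaw_pos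
  filter_upwards [htotal, hpos] with ω hω hs
  refine propext ⟨?_, ?_⟩
  -- As `j ≤ size k`, the truncated subtraction `size k - j` is a true one, so that having `j`
  -- particles at `δ(+)` and `size k - j` at `δ(-)` leaves none at the sites.
  · rintro ⟨t, -, h1, h2⟩
    have h := hω (ringCount ω.2 t)
    refine ⟨ringCount ω.2 t, ?_, h1, h⟩
    change ω.1 (ringCount ω.2 t) .deltaPlus = j at h1
    change ω.1 (ringCount ω.2 t) .deltaMinus = size k - j at h2
    rw [total, htot] at h
    omega
  -- The state at step `m` is the one at the time of the `m`-th ring.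
  · rintro ⟨m, h0, h1, h⟩
    refine ⟨∑ i ∈ Finset.range m, ω.2 i, Finset.sum_nonneg fun i _ => (hs i).le, ?_⟩
    rw [stateAt, ringCount_sum hs]
    rw [total, htot] at h
    exact ⟨h1, by omega⟩

end KMPModel

theorem corollary3p2 (M : KMPModel) (μ : Measure (Energy M.L)) [IsProbabilityMeasure μ]
    (hμ : M.kmp.IsInvariant μ) (k : Config M.L)
    (hk_minus : k .deltaMinus = 0) (hk_plus : k .deltaPlus = 0) :
    Integrable (fun ξ => M.F k ξ) μ ∧
      ∫ ξ, M.F k ξ ∂μ =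
        ∑ j ∈ Finset.range (KMPModel.size k + 1),
          1 / (M.βp ^ j * M.βm ^ (KMPModel.size k - j)) * M.hitProb k j := by
  have htot : KMPModel.total k = KMPModel.size k := by
    simp [KMPModel.total, hk_minus, hk_plus]
  have h := M.lintegral_F_eq (hμ.invariant_jumpKernel) k
  have hm := (M.measurable_F k).aestronglyMeasurable (μ := μ)
  have hnn : 0 ≤ᵐ[μ] M.F k := .of_forall (M.F_nonneg k)
  refine ⟨(lintegral_ofReal_ne_top_iff_integrable hm hnn).1
    (h ▸ M.sum_absorbedValue_mul_ne_top k), ?_⟩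
  have hβp := M.βp_pos
  have hβm := M.βm_pos
  rw [integral_eq_lintegral_of_nonneg_ae hnn hm, h,
    ENNReal.toReal_sum (ENNReal.sum_ne_top.1 (M.sum_absorbedValue_mul_ne_top k)), htot]
  refine Finset.sum_congr rfl fun j hj => ?_
  rw [ENNReal.toReal_mul, KMPModel.absorbedValue, ENNReal.toReal_ofReal (by positivity),
    M.hitProb_eq k hk_minus hk_plus (Nat.lt_succ_iff.1 (Finset.mem_range.1 hj))]
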